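/- Let $d\ge 0$, $M\ge 1$, $T\ge 1$ be integers and let $x_{t+1}=f(x_t,w_t)$, $t\ge 0$, be an $\mathbb R^d$-valued Markov source, where $f:\mathbb R^d\times\mathbb R^d\to\mathbb R^d$ is Borel, $(w_t)_{t\ge0}$ is i.i.d. and independent of $x_0$, and $x_0$ has law $\pi_0$. Assume that for every $x$ the law $P(\cdot\,|x)$ of $f(x,w_t)$ has a density $\phi(\cdot|x)$ with respect to Lebesgue measure with $0<\phi(z|x)\le C$ for all $z$, and with Lipschitz constant $C_1$ in $z$, where $C$ and $C_1$ do not depend on $x$. Let $\mathsf U$ be a nonempty compact metric space and let $c_0:\mathbb R^d\times\mathsf U\to\mathbb R$ be nonnegative, bounded and continuous. Suppose that $\pi_0$ has a density or is a point mass. A quantizer is a Borel map $Q:\mathbb R^d\to\{1,\dots,M\}$, and $\mathcal Q_c$ is the set of quantizers all of whose cells $Q^{-1}(i)$ are convex (the empty set is allowed). A quantization policy $\Pi$ is a sequence of Borel maps $\eta_t$, which produce messages $q_t=\eta_t(q_0,\dots,q_{t-1},x_0,\dots,x_t)\in\{1,\dots,M\}$. A receiver policy $\gamma$ is a sequence of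 maps $\gamma_t:\{1,\dots,M\}^{t+1}\to\mathsf U$. Put $$J_{\pi_0}(\Pi,T)=\inf_\gamma E\Bigl[\frac1T\sum_{t=0}^{T-1}c_0\bigl(x_t,\gamma_t(q_0,\dots,q_t)\bigr)\Bigr].$$ Let $\pi_t$ denote the regular conditional law of $x_t$ given $(q_0,\dots,q_{t-1})$. The class $\Pi_W^C$ consists of the policies for which there are maps $\hat\eta_t$ from the probability measures on $\mathbb R^d$ to $\mathcal Q_c$ with $q_t=Q_t(x_t)$ almost surely, $Q_t=\hat\eta_t(\pi_t)$, for all $t\ge0$. For a probability measure $\pi$ on $\mathbb R^d$ and $Q\in\mathcal Q_c$ let $$c(\pi,Q)=\sum_{i=1}^M\inf_{u\in\mathsf U}\int_{Q^{-1}(i)}c_0(x,u)\,\pi(dx),$$ and let $\hat\pi(m,\pi,Q)=\pi(Q^{-1}(m))^{-1}\int_{Q^{-1}(m)}P(\cdot\,|x)\,\pi(dx)$ (an arbitrary probability measure if $\pi(Q^{-1}(m))=0$). Define $J^T_T=0$ and, for $t=T-1,\dots,0$, $$J^T_t(\pi)=\inf_{Q\in\mathcal Q_c}\Bigl(\frac1T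 c(\pi,Q)+\sum_{m=1}^M\pi(Q^{-1}(m))\,J^T_{t+1}\bigl(\hat\pi(m,\pi,Q)\bigr)\Bigr),$$ where the sum over $m$ is $E[J^T_{t+1}(\pi_{t+1})\mid\pi_t=\pi,Q_t=Q]$. Let $\mathcal S$ be the set of probability measures on $\mathbb R^d$ with a density which is bounded by $C$ and Lipschitz with constant $C_1$. Then: 1. There is $\Pi\in\Pi_W^C$ with $J_{\pi_0}(\Pi,T)=\inf_{\Pi'\in\Pi_W^C}J_{\pi_0}(\Pi',T)$. 2. $J^T_0(\pi_0)=\min_{\Pi\in\Pi_W^C}J_{\pi_0}(\Pi,T)$. 3. For $1\le t\le T-1$ and $\pi\in\mathcal S$, and for $t=0$ and $\pi\in\mathcal S\cup\{\pi_0\}$, the infimum that defines $J^T_t(\pi)$ is attained by some $Q\in\mathcal Q_c$. 4. For $0\le t\le T-1$, $J^T_t$ is continuous on $\mathcal S$ with the topology of weak convergence. -/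

import Mathlib

open MeasureTheory ProbabilityTheory
open scoped NNReal ENNReal

namespace ZeroDelay

/-- The source space `ℝ^d` with its Euclidean norm. -/
abbrev E (d : ℕ) : Type := EuclideanSpace ℝ (Fin d)

/-! ### The source -/

/-- The data of a Markov source `x_{t+1} = f (x_t, w_t)`: a Borel map `f` and the common law of
the noise variables `w_t`. -/
structure SourceModel (d : ℕ) where
  f : E d → E d → E d
  measurable_f : Measurable (Function.uncurry f)
  noise : ProbabilityMeasure (E d)

/-- The transition kernel of the source: `x ↦` law of `f (x, w)`. -/
noncomputable def SourceModel.kernel {d : ℕ} (S : SourceModel d) : Kernel (E d) (E d) :=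
  (Kernel.id ×ₖ Kernel.const (E d) (S.noise : Measure (E d))).map (Function.uncurry S.f)

instance {d : ℕ} (S : SourceModel d) : IsMarkovKernel S.kernel :=
  Kernel.IsMarkovKernel.map _ S.measurable_f

theorem SourceModel.kernel_apply {d : ℕ} (S : SourceModel d) (x : E d) :
    S.kernel x = (S.noise : Measure (E d)).map (S.f x) := by
  have h2 : Measurable (Prod.mk x : E d → E d × E d) := measurable_prodMk_left
  rw [SourceModel.kernel, Kernel.map_apply _ S.measurable_f, Kernel.prod_apply, Kernel.id_apply,
    Kernel.const_apply, Measure.dirac_prod, Measure.map_map S.measurable_f h2]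
  rfl

/-- `f (x, w)` has a density `φ x` (in Lean notation `φ x z` stands for `φ(z|x)`), for every `x`,
which is everywhere positive, bounded by `C` and `K`-Lipschitz, with `C` and `K` independent
of `x`. -/
structure SourceModel.HasRegularDensity {d : ℕ} (S : SourceModel d) (φ : E d → E d → ℝ)
    (C : ℝ) (K : ℝ≥0) : Prop where
  density : ∀ x, (S.noise : Measure (E d)).map (S.f x) =
    volume.withDensity (fun z => ENNReal.ofReal (φ x z))
  pos : ∀ x z, 0 < φ x z
  le : ∀ x z, φ x z ≤ C
  lipschitz : ∀ x, LipschitzWith K (φ x)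

/-- `X` is the source process with initial law `π₀` driven by the i.i.d. noise `W`, which is
independent of `X 0`, on the probability space `(Ω, μ)`. -/
structure SourceModel.IsDrivenBy {d : ℕ} (S : SourceModel d)
    (π₀ : ProbabilityMeasure (E d)) {Ω : Type*} [MeasurableSpace Ω] (μ : Measure Ω)
    (X W : ℕ → Ω → E d) : Prop where
  measurable_init : Measurable (X 0)
  map_init : μ.map (X 0) = π₀
  measurable_noise : ∀ t, Measurable (W t)
  map_noise : ∀ t, μ.map (W t) = S.noise
  iIndep_noise : iIndepFun W μ
  indep_init : IndepFun (X 0) (fun ω t => W t ω) μ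
  step : ∀ t ω, X (t + 1) ω = S.f (X t ω) (W t ω)

/-- The probability measures on `ℝ^d` with a density bounded by `C` and `K`-Lipschitz. -/
def regularLaws (d : ℕ) (C : ℝ) (K : ℝ≥0) : Set (ProbabilityMeasure (E d)) :=
  {π | ∃ g : E d → ℝ, (∀ z, 0 ≤ g z) ∧ (∀ z, g z ≤ C) ∧ LipschitzWith K g ∧
    (π : Measure (E d)) = volume.withDensity (fun z => ENNReal.ofReal (g z))}

/-- A probability measure on `ℝ^d` which has a density with respect to Lebesgue measure. -/
def AdmitsDensity {d : ℕ} (π : ProbabilityMeasure (E d)) : Prop :=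
  ∃ g : E d → ℝ≥0∞, Measurable g ∧ (π : Measure (E d)) = volume.withDensity g

/-! ### Quantizers -/

/-- An `M`-cell quantizer: a Borel map from `ℝ^d` to the message set (with `M` elements). -/
structure Quantizer (d M : ℕ) where
  toFun : E d → Fin M
  measurable : Measurable toFun

/-- The `i`-th cell of a quantizer. -/
def Quantizer.cell {d M : ℕ} (Q : Quantizer d M) (i : Fin M) : Set (E d) := Q.toFun ⁻¹' {i}

/-- The quantizers all of whose cells are convex (possibly empty). -/
def convexQuantizers (d M : ℕ) : Set (Quantizer d M) := {Q | ∀ i, Convex ℝ (Q.cell i)}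

/-! ### Encoders, receivers and costs -/

/-- An admissible (zero-delay) quantization policy: Borel maps
`η_t (q_{[0,t-1]}, x_{[0,t]})`. -/
structure Policy (d M : ℕ) where
  enc : (t : ℕ) → (Fin t → Fin M) → (Fin (t + 1) → E d) → Fin M
  measurable : ∀ t, Measurable
    (fun p : (Fin t → Fin M) × (Fin (t + 1) → E d) => enc t p.1 p.2)

/-- The messages `q_{[0,t-1]}` produced along a source trajectory `x`. -/
def Policy.messages {d M : ℕ} (η : Policy d M) (x : ℕ → E d) : (t : ℕ) → (Fin t → Fin M)
  | 0 => Fin.elim0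
  | t + 1 => Fin.snoc (α := fun _ => Fin M) (η.messages x t)
      (η.enc t (η.messages x t) (fun i => x i))

/-- A receiver policy: maps `u_t = γ_t (q_{[0,t]})` (measurability is automatic, the domains
being finite and discrete). -/
abbrev Receiver (M : ℕ) (U : Type*) : Type _ := (t : ℕ) → (Fin (t + 1) → Fin M) → U

section Coding

variable {d M : ℕ} {U Ω : Type*} [MeasurableSpace Ω]

/-- The average cost over `T` stages of a quantization policy and a receiver policy. -/
noncomputable def averageCost (μ : Measure Ω) (X : ℕ → Ω → E d) (c₀ : E d → U → ℝ) (T : ℕ)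
    (η : Policy d M) (γ : Receiver M U) : ℝ :=
  ∫ ω, (1 / (T : ℝ)) * ∑ t ∈ Finset.range T,
    c₀ (X t ω) (γ t (η.messages (fun s => X s ω) (t + 1))) ∂μ

/-- The average cost over `T` stages of a quantization policy: infimum over the receivers. -/
noncomputable def policyCost (μ : Measure Ω) (X : ℕ → Ω → E d) (c₀ : E d → U → ℝ) (T : ℕ)
    (η : Policy d M) : ℝ :=
  ⨅ γ : Receiver M U, averageCost μ X c₀ T η γ

/-- The random measure `π_t`: regular conditional law of `x_t` given `q_{[0,t-1]}`. -/
noncomputable def belief (μ : Measure Ω) [IsProbabilityMeasure μ] (X : ℕ → Ω → E d)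
    (η : Policy d M) (t : ℕ) (ω : Ω) : ProbabilityMeasure (E d) :=
  ⟨condDistrib (X t) (fun ω' => η.messages (fun s => X s ω') t) μ
    (η.messages (fun s => X s ω) t), inferInstance⟩

/-- The Walrand–Varaiya-type policies with quantizers in `𝒬`: for some maps `η̂_t` from
probability measures to `𝒬`, the message is (almost surely) `q_t = Q_t (x_t)` with
`Q_t = η̂_t (π_t)`. -/
def walrandVaraiya (μ : Measure Ω) [IsProbabilityMeasure μ] (X : ℕ → Ω → E d)
    (𝒬 : Set (Quantizer d M)) : Set (Policy d M) :=
  {η | ∃ ηhat : ℕ → ProbabilityMeasure (E d) → Quantizer d M,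
    (∀ t π, ηhat t π ∈ 𝒬) ∧
    ∀ t, ∀ᵐ ω ∂μ, η.enc t (η.messages (fun s => X s ω) t) (fun i => X i ω) =
      (ηhat t (belief μ X η t ω)).toFun (X t ω)}

end Coding

/-! ### Dynamic programming -/

section DynamicProgramming

variable {d M : ℕ} {U : Type*}

/-- `c(π, Q) = ∑_i inf_u ∫_{B_i} c₀(x, u) π(dx)`. -/
noncomputable def stageCost (c₀ : E d → U → ℝ) (π : ProbabilityMeasure (E d))
    (Q : Quantizer d M) : ℝ :=
  ∑ i : Fin M, ⨅ u : U, ∫ x in Q.cell i, c₀ x u ∂(π : Measure (E d))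

open Classical in
/-- The next conditional law, when the current one is `π`, the quantizer `Q` is used and the
message is `m`: `π(B_m)⁻¹ ∫_{B_m} P(·|x) π(dx)`. It does not matter which value is taken when
`π(B_m) = 0`. -/
noncomputable def nextLaw (S : SourceModel d) (π : ProbabilityMeasure (E d))
    (Q : Quantizer d M) (m : Fin M) : ProbabilityMeasure (E d) :=
  if h : (π : Measure (E d)) (Q.cell m) = 0 then
    ⟨(π : Measure (E d)).bind S.kernel, inferInstance⟩
  else
    ⟨(ProbabilityTheory.cond (π : Measure (E d)) (Q.cell m)).bind S.kernel,
      haveI := cond_isProbabilityMeasure h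
      inferInstance⟩

/-- `E[J(π_{t+1}) | π_t = π, Q_t = Q]`: the message `m` has conditional probability `π(B_m)`,
and leads to the conditional law `nextLaw S π Q m`. -/
noncomputable def expectNext (S : SourceModel d) (J : ProbabilityMeasure (E d) → ℝ)
    (π : ProbabilityMeasure (E d)) (Q : Quantizer d M) : ℝ :=
  ∑ m : Fin M, (π : Measure (E d)).real (Q.cell m) * J (nextLaw S π Q m)

/-- The optimal cost over the last `n` of `T` stages, by recursion on `n`. -/
noncomputable def costToGo (S : SourceModel d) (M : ℕ) (c₀ : E d → U → ℝ) (T : ℕ) :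
    ℕ → ProbabilityMeasure (E d) → ℝ
  | 0 => fun _ => 0
  | n + 1 => fun π => ⨅ Q : convexQuantizers d M,
      ((1 / (T : ℝ)) * stageCost c₀ π Q.1 + expectNext S (costToGo S M c₀ T n) π Q.1)

/-- The value function `J^T_t`, for `t ≤ T`. -/
noncomputable def value (S : SourceModel d) (M : ℕ) (c₀ : E d → U → ℝ) (T t : ℕ) :
    ProbabilityMeasure (E d) → ℝ :=
  costToGo S M c₀ T (T - t)

theorem value_last (S : SourceModel d) (M : ℕ) (c₀ : E d → U → ℝ) (T : ℕ)
    (π : ProbabilityMeasure (E d)) : value S M c₀ T T π = 0 := by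
  simp [value, costToGo]

theorem value_of_lt (S : SourceModel d) (M : ℕ) (c₀ : E d → U → ℝ) (T t : ℕ) (h : t < T)
    (π : ProbabilityMeasure (E d)) :
    value S M c₀ T t π = ⨅ Q : convexQuantizers d M,
      ((1 / (T : ℝ)) * stageCost c₀ π Q.1 + expectNext S (value S M c₀ T (t + 1)) π Q.1) := by
  have h1 : T - t = (T - (t + 1)) + 1 := by omega
  simp only [value, h1, costToGo]

end DynamicProgramming

end ZeroDelay

/-!
# Optimal zero-delay quantizers with convex cells

Why the theorem is true. Work with unnormalised laws: to an event "the messages so far are `q`"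
attach the finite measure `μ (x_t ∈ ·, messages = q)`, whose mass is the probability of the event.
A new message restricts this measure to a cell, and passing to the next time transports it by the
kernel, so no division by `π (B_m)` ever occurs. The value functions extend homogeneously to finite
measures (`unnormCost`), and the extension satisfies `G ν ≤ G (ν + ρ) ≤ G ν + L ρ(univ)`
(`unnormCost_mono`, `unnormCost_add_le`). Hence all costs are Lipschitz in total variation.

* *Continuity.* Laws with uniformly Lipschitz densities have pointwise convergent densities when
  they converge weakly, because the density is recovered from the measures of small balls. By
  dominated convergence (Scheffé) they converge in total variation (`continuousOn_costToGo`).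

* *Optimal quantizers.* The maps `E d → Fin M` with convex cells form a closed subset of a product
  of finite spaces, hence a compact set for pointwise convergence. Every such map is automatically
  Borel (`measurableSet_preimage_of_convex`), so the limit is an admissible quantizer. A pointwise
  limit is locally uniform off the boundaries of the limiting cells, which are Lebesgue null; so
  against an absolutely continuous law the cost is continuous on this compact set
  (`continuousOn_sum_branchCost`) and attains its minimum. For a point mass every quantizer is
  optimal. All conditional laws after time `0` are regular, being mixtures of the transition
  densities (`nextLaw_mem_regularLaws`).

* *Verification.* The sum over `q` of the homogeneous value functions at the unnormalised laws drops
  at each time by at most the stage cost, with equality when the quantizers in use are minimisers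
  (`UsesQuantizers.value_le`, `UsesQuantizers.policyCost_eq_value`). Equality is achieved by running
  the filter `filterLaw` and quantizing optimally for its output; the filter is the regular
  conditional law of the state, so this policy is of Walrand–Varaiya type.
-/

namespace ZeroDelay

/-! ### The cost-to-go on unnormalised laws -/

section Unnormalised

variable {d M : ℕ} {U : Type*}

theorem Quantizer.measurableSet_cell (Q : Quantizer d M) (m : Fin M) :
    MeasurableSet (Q.cell m) :=
  Q.measurable (measurableSet_singleton m)

theorem nonempty_convexQuantizers (hM : 1 ≤ M) : Nonempty (convexQuantizers d M) := by
  refine ⟨⟨⟨fun _ => ⟨0, hM⟩, measurable_const⟩, fun i => ?_⟩⟩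
  by_cases h : (⟨0, hM⟩ : Fin M) = i
  · simp [Quantizer.cell, h, convex_univ]
  · simp [Quantizer.cell, h, convex_empty]

theorem Quantizer.sum_restrict_cell (Q : Quantizer d M) (ν : Measure (E d)) [IsFiniteMeasure ν] :
    ∑ m, ν.real (Q.cell m) = ν.real Set.univ := by
  have h := measureReal_biUnion_finset (μ := ν) (s := Finset.univ) (f := Q.cell)
    (fun i _ j _ hij => Set.disjoint_left.2 fun x hx hy => hij (by
      rw [← show Q.toFun x = i from hx, show Q.toFun x = j from hy]))
    (fun m _ => Q.measurableSet_cell m)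
  rw [← h]
  congr 1
  ext x
  simp [Quantizer.cell]

/-- The infimum over receiver actions of the integral of the cost against `ν`. -/
noncomputable def actionCost (c₀ : E d → U → ℝ) (ν : Measure (E d)) : ℝ :=
  ⨅ u : U, ∫ x, c₀ x u ∂ν

/-- The positively homogeneous extension of `costToGo` from probability measures to finite
measures: a measure `ν` stands for the law of the state on an event, of mass `ν univ`. Conditioning
on a message then becomes restriction to a cell, and no normalisation is needed. -/
noncomputable def unnormCost (S : SourceModel d) (M : ℕ) (c₀ : E d → U → ℝ) (T : ℕ) :
    ℕ → Measure (E d) → ℝ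
  | 0 => fun _ => 0
  | n + 1 => fun ν => ⨅ Q : convexQuantizers d M, ∑ m : Fin M,
      ((1 / (T : ℝ)) * actionCost c₀ (ν.restrict (Q.1.cell m)) +
        unnormCost S M c₀ T n ((ν.restrict (Q.1.cell m)).bind S.kernel))

/-- The optimal cost with `n + 1` stages to go, once the current message has been received; `ν` is
the unnormalised law of the state given the messages up to and including the current one. -/
noncomputable def branchCost (S : SourceModel d) (M : ℕ) (c₀ : E d → U → ℝ) (T n : ℕ)
    (ν : Measure (E d)) : ℝ :=
  (1 / (T : ℝ)) * actionCost c₀ ν + unnormCost S M c₀ T n (ν.bind S.kernel)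

theorem unnormCost_succ (S : SourceModel d) (c₀ : E d → U → ℝ) (T n : ℕ) (ν : Measure (E d)) :
    unnormCost S M c₀ T (n + 1) ν = ⨅ Q : convexQuantizers d M, ∑ m : Fin M,
      branchCost S M c₀ T n (ν.restrict (Q.1.cell m)) := rfl

variable {S : SourceModel d} {c₀ : E d → U → ℝ} {T : ℕ} {ν ρ : Measure (E d)} {B : ℝ}

theorem actionCost_nonneg (hc : ∀ x u, 0 ≤ c₀ x u) (ν : Measure (E d)) : 0 ≤ actionCost c₀ ν :=
  Real.iInf_nonneg fun u => integral_nonneg fun x => hc x u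

theorem bddBelow_integral (hc : ∀ x u, 0 ≤ c₀ x u) (ν : Measure (E d)) :
    BddBelow (Set.range fun u => ∫ x, c₀ x u ∂ν) :=
  ⟨0, by rintro _ ⟨u, rfl⟩; exact integral_nonneg fun x => hc x u⟩

theorem actionCost_le (hc : ∀ x u, 0 ≤ c₀ x u) (ν : Measure (E d)) (u : U) :
    actionCost c₀ ν ≤ ∫ x, c₀ x u ∂ν :=
  ciInf_le (bddBelow_integral hc ν) u

theorem unnormCost_nonneg (hc : ∀ x u, 0 ≤ c₀ x u) :
    ∀ (n : ℕ) (ν : Measure (E d)), 0 ≤ unnormCost S M c₀ T n ν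
  | 0, _ => le_rfl
  | n + 1, ν => Real.iInf_nonneg fun Q => Finset.sum_nonneg fun m _ =>
      add_nonneg (mul_nonneg (by positivity) (actionCost_nonneg hc _)) (unnormCost_nonneg hc n _)

theorem branchCost_nonneg (hc : ∀ x u, 0 ≤ c₀ x u) (n : ℕ) (ν : Measure (E d)) :
    0 ≤ branchCost S M c₀ T n ν :=
  add_nonneg (mul_nonneg (by positivity) (actionCost_nonneg hc _)) (unnormCost_nonneg hc n _)

theorem bddBelow_sum_branchCost (hc : ∀ x u, 0 ≤ c₀ x u) (n : ℕ) (ν : Measure (E d)) :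
    BddBelow (Set.range fun Q : convexQuantizers d M =>
      ∑ m : Fin M, branchCost S M c₀ T n (ν.restrict (Q.1.cell m))) :=
  ⟨0, by rintro _ ⟨Q, rfl⟩; exact Finset.sum_nonneg fun m _ => branchCost_nonneg hc n _⟩

theorem unnormCost_le (hc : ∀ x u, 0 ≤ c₀ x u) (n : ℕ) (ν : Measure (E d))
    {Q : Quantizer d M} (hQ : Q ∈ convexQuantizers d M) :
    unnormCost S M c₀ T (n + 1) ν ≤ ∑ m, branchCost S M c₀ T n (ν.restrict (Q.cell m)) :=
  ciInf_le (bddBelow_sum_branchCost hc n ν) (⟨Q, hQ⟩ : convexQuantizers d M)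

theorem integrable_cost (hm : ∀ u, Measurable fun x => c₀ x u) (hc : ∀ x u, 0 ≤ c₀ x u)
    (hB : ∀ x u, c₀ x u ≤ B) (ν : Measure (E d)) [IsFiniteMeasure ν] (u : U) :
    Integrable (fun x => c₀ x u) ν :=
  Integrable.of_bound (hm u).aestronglyMeasurable B
    (.of_forall fun x => by rw [Real.norm_of_nonneg (hc x u)]; exact hB x u)

theorem actionCost_mono [Nonempty U] (hm : ∀ u, Measurable fun x => c₀ x u)
    (hc : ∀ x u, 0 ≤ c₀ x u) (hB : ∀ x u, c₀ x u ≤ B) [IsFiniteMeasure ν] [IsFiniteMeasure ρ] :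
    actionCost c₀ ν ≤ actionCost c₀ (ν + ρ) := by
  refine ciInf_mono (bddBelow_integral hc ν) fun u => ?_
  rw [integral_add_measure (integrable_cost hm hc hB _ u) (integrable_cost hm hc hB _ u)]
  exact le_add_of_nonneg_right (integral_nonneg fun x => hc x u)

theorem actionCost_add_le [Nonempty U] (hm : ∀ u, Measurable fun x => c₀ x u)
    (hc : ∀ x u, 0 ≤ c₀ x u) (hB : ∀ x u, c₀ x u ≤ B) [IsFiniteMeasure ν] [IsFiniteMeasure ρ] :
    actionCost c₀ (ν + ρ) ≤ actionCost c₀ ν + B * ρ.real Set.univ := by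
  rw [← sub_le_iff_le_add]
  refine le_ciInf fun u => ?_
  rw [sub_le_iff_le_add]
  refine (actionCost_le hc _ u).trans ?_
  rw [integral_add_measure (integrable_cost hm hc hB _ u) (integrable_cost hm hc hB _ u)]
  gcongr
  calc ∫ x, c₀ x u ∂ρ ≤ ∫ _, B ∂ρ :=
        integral_mono (integrable_cost hm hc hB _ u) (integrable_const _) fun x => hB x u
    _ = B * ρ.real Set.univ := by simp [mul_comm]

theorem real_bind_kernel_univ (S : SourceModel d) (ν : Measure (E d)) :
    (ν.bind S.kernel).real Set.univ = ν.real Set.univ := by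
  simp [Measure.real, Measure.bind_apply MeasurableSet.univ S.kernel.aemeasurable]

theorem unnormCost_mono [Nonempty U] (hm : ∀ u, Measurable fun x => c₀ x u)
    (hc : ∀ x u, 0 ≤ c₀ x u) (hB : ∀ x u, c₀ x u ≤ B) (hM : 1 ≤ M) (n : ℕ) :
    ∀ (ν ρ : Measure (E d)) [IsFiniteMeasure ν] [IsFiniteMeasure ρ],
      unnormCost S M c₀ T n ν ≤ unnormCost S M c₀ T n (ν + ρ) := by
  induction n with
  | zero => intro ν ρ _ _; exact le_rfl
  | succ n ih =>
    intro ν ρ _ _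
    have := nonempty_convexQuantizers (d := d) hM
    refine ciInf_mono (bddBelow_sum_branchCost hc n ν) fun Q => Finset.sum_le_sum fun m _ => ?_
    rw [Measure.restrict_add, Measure.comp_add]
    gcongr
    · exact actionCost_mono hm hc hB
    · exact ih _ _

/-- Adding mass `ρ` raises the cost by at most a constant times `ρ univ`, uniformly in all other
data; this makes every cost of the recursion Lipschitz in total variation. -/
theorem unnormCost_add_le [Nonempty U] (hm : ∀ u, Measurable fun x => c₀ x u)
    (hc : ∀ x u, 0 ≤ c₀ x u) (hB : ∀ x u, c₀ x u ≤ B) (hM : 1 ≤ M) (n : ℕ) :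
    ∀ (ν ρ : Measure (E d)) [IsFiniteMeasure ν] [IsFiniteMeasure ρ],
      unnormCost S M c₀ T n (ν + ρ) ≤
        unnormCost S M c₀ T n ν + n * (1 / (T : ℝ) * B) * ρ.real Set.univ := by
  induction n with
  | zero => intro ν ρ _ _; simp [unnormCost]
  | succ n ih =>
    intro ν ρ _ _
    have := nonempty_convexQuantizers (d := d) hM
    rw [← sub_le_iff_le_add]
    refine le_ciInf fun Q => ?_
    rw [sub_le_iff_le_add]
    refine (unnormCost_le hc n _ Q.2).trans ?_
    rw [← Q.1.sum_restrict_cell ρ, Finset.mul_sum, ← Finset.sum_add_distrib]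
    refine Finset.sum_le_sum fun m _ => ?_
    rw [branchCost, Measure.restrict_add, Measure.comp_add]
    have h1 := actionCost_add_le hm hc hB (ν := ν.restrict (Q.1.cell m))
      (ρ := ρ.restrict (Q.1.cell m))
    have h2 := ih ((ν.restrict (Q.1.cell m)).bind S.kernel)
      ((ρ.restrict (Q.1.cell m)).bind S.kernel)
    rw [real_bind_kernel_univ, measureReal_restrict_apply_univ] at h2
    rw [measureReal_restrict_apply_univ] at h1
    have h3 := mul_le_mul_of_nonneg_left h1 (show (0 : ℝ) ≤ 1 / T by positivity)
    push_cast
    linarith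

theorem branchCost_mono [Nonempty U] (hm : ∀ u, Measurable fun x => c₀ x u)
    (hc : ∀ x u, 0 ≤ c₀ x u) (hB : ∀ x u, c₀ x u ≤ B) (hM : 1 ≤ M) (n : ℕ)
    [IsFiniteMeasure ν] [IsFiniteMeasure ρ] :
    branchCost S M c₀ T n ν ≤ branchCost S M c₀ T n (ν + ρ) := by
  rw [branchCost, branchCost, Measure.comp_add]
  gcongr
  · exact actionCost_mono hm hc hB
  · exact unnormCost_mono hm hc hB hM n _ _

theorem branchCost_add_le [Nonempty U] (hm : ∀ u, Measurable fun x => c₀ x u)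
    (hc : ∀ x u, 0 ≤ c₀ x u) (hB : ∀ x u, c₀ x u ≤ B) (hM : 1 ≤ M) (n : ℕ)
    [IsFiniteMeasure ν] [IsFiniteMeasure ρ] :
    branchCost S M c₀ T n (ν + ρ) ≤
      branchCost S M c₀ T n ν + (n + 1) * (1 / (T : ℝ) * B) * ρ.real Set.univ := by
  rw [branchCost, branchCost, Measure.comp_add]
  have h1 := actionCost_add_le hm hc hB (ν := ν) (ρ := ρ)
  have h2 := unnormCost_add_le (S := S) (T := T) hm hc hB hM n (ν.bind S.kernel) (ρ.bind S.kernel)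
  rw [real_bind_kernel_univ] at h2
  have h3 := mul_le_mul_of_nonneg_left h1 (show (0 : ℝ) ≤ 1 / T by positivity)
  linarith

theorem actionCost_smul (a : ℝ≥0) (ν : Measure (E d)) :
    actionCost c₀ (a • ν) = a * actionCost c₀ ν := by
  rw [actionCost, actionCost, Real.mul_iInf_of_nonneg a.coe_nonneg]
  simp only [integral_smul_nnreal_measure]
  rfl

theorem unnormCost_smul (n : ℕ) (a : ℝ≥0) :
    ∀ ν : Measure (E d), unnormCost S M c₀ T n (a • ν) = a * unnormCost S M c₀ T n ν := by
  induction n with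
  | zero => intro ν; simp [unnormCost]
  | succ n ih =>
    intro ν
    rw [unnormCost_succ, unnormCost_succ, Real.mul_iInf_of_nonneg a.coe_nonneg]
    congr 1
    ext Q
    rw [Finset.mul_sum]
    refine Finset.sum_congr rfl fun m _ => ?_
    rw [Measure.restrict_smul, branchCost, Measure.bind_smul, ih, actionCost_smul, branchCost]
    ring

theorem branchCost_smul (n : ℕ) (a : ℝ≥0) (ν : Measure (E d)) :
    branchCost S M c₀ T n (a • ν) = a * branchCost S M c₀ T n ν := by
  rw [branchCost, Measure.bind_smul, unnormCost_smul, actionCost_smul, branchCost]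
  ring

theorem branchCost_zero (n : ℕ) : branchCost S M c₀ T n (0 : Measure (E d)) = 0 := by
  simpa using branchCost_smul (S := S) (M := M) (c₀ := c₀) (T := T) n 0 (0 : Measure (E d))

/-- The unnormalised conditional law after message `m` is `π (B_m)` times the normalised one. -/
theorem bind_restrict_cell (S : SourceModel d) (π : ProbabilityMeasure (E d)) (Q : Quantizer d M)
    (m : Fin M) :
    ((π : Measure (E d)).restrict (Q.cell m)).bind S.kernel =
      ((π : Measure (E d)) (Q.cell m)).toNNReal • (nextLaw S π Q m : Measure (E d)) := by
  by_cases h : (π : Measure (E d)) (Q.cell m) = 0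
  · rw [Measure.restrict_eq_zero.2 h, h]
    simp
  · have h2 : (nextLaw S π Q m : Measure (E d)) =
        (ProbabilityTheory.cond (π : Measure (E d)) (Q.cell m)).bind S.kernel :=
      congrArg Subtype.val (dif_neg h)
    rw [h2, ProbabilityTheory.cond, Measure.comp_smul, ENNReal.smul_def,
      ENNReal.coe_toNNReal (measure_ne_top _ _), smul_smul,
      ENNReal.mul_inv_cancel h (measure_ne_top _ _), one_smul]

theorem unnormCost_coe (n : ℕ) :
    ∀ π : ProbabilityMeasure (E d), unnormCost S M c₀ T n π = costToGo S M c₀ T n π := by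
  induction n with
  | zero => intro π; rfl
  | succ n ih =>
    intro π
    rw [unnormCost, costToGo]
    refine congrArg iInf (funext fun Q => ?_)
    rw [Finset.sum_add_distrib, stageCost, expectNext, Finset.mul_sum]
    congr 1
    refine Finset.sum_congr rfl fun m _ => ?_
    rw [bind_restrict_cell, unnormCost_smul, ih]
    rfl

/-- The function minimised in the dynamic programming recursion, as a sum over the cells. -/
theorem stageCost_add_expectNext (n : ℕ) (π : ProbabilityMeasure (E d)) (Q : Quantizer d M) :
    (1 / (T : ℝ)) * stageCost c₀ π Q + expectNext S (costToGo S M c₀ T n) π Q =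
      ∑ m, branchCost S M c₀ T n ((π : Measure (E d)).restrict (Q.cell m)) := by
  rw [stageCost, expectNext, Finset.mul_sum, ← Finset.sum_add_distrib]
  refine Finset.sum_congr rfl fun m _ => ?_
  rw [branchCost, bind_restrict_cell, unnormCost_smul, unnormCost_coe]
  rfl

end Unnormalised

/-! ### Partitions into finitely many convex cells -/

section ConvexPartitions

open Set Filter Topology

/-- In finite dimension a convex set can be weakly separated from a point outside it, even when it
has empty interior: it then lies in a hyperplane. -/
theorem exists_ne_zero_forall_le_zero {V : Type*} [NormedAddCommGroup V] [NormedSpace ℝ V]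
    [FiniteDimensional ℝ V] {D : Set V} (hD : Convex ℝ D) (hne : D.Nonempty) (h0 : (0 : V) ∉ D) :
    ∃ f : StrongDual ℝ V, f ≠ 0 ∧ ∀ x ∈ D, f x ≤ 0 := by
  by_cases hint : (interior D).Nonempty
  · obtain ⟨f, u, hf, h1, h2⟩ := geometric_hahn_banach_of_nonempty_interior hD
      (convex_singleton (0 : V)) (disjoint_singleton_right.2 fun h => h0 (interior_subset h)) hint
      (singleton_nonempty 0)
    refine ⟨f, hf, fun x hx => (h1 x hx).trans ?_⟩
    simpa using h2 0 rfl
  · rw [hD.interior_nonempty_iff_affineSpan_eq_top] at hint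
    obtain ⟨x₀, hx₀⟩ := hne
    have hdir : (affineSpan ℝ D).direction < ⊤ := lt_top_iff_ne_top.2 fun h =>
      hint ((AffineSubspace.direction_eq_top_iff_of_nonempty
        ⟨x₀, subset_affineSpan ℝ D hx₀⟩).1 h)
    obtain ⟨f, hf, hker⟩ := Submodule.exists_le_ker_of_lt_top _ hdir
    have hconst : ∀ x ∈ D, f x = f x₀ := fun x hx => by
      have := hker (AffineSubspace.vsub_mem_direction (subset_affineSpan ℝ D hx)
        (subset_affineSpan ℝ D hx₀))
      rw [LinearMap.mem_ker, vsub_eq_sub, map_sub] at this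
      linarith
    have hf' : f.toContinuousLinearMap ≠ 0 := by simpa using hf
    rcases le_total (f x₀) 0 with h | h
    · exact ⟨f.toContinuousLinearMap, hf', fun x hx => by simpa [hconst x hx] using h⟩
    · exact ⟨-f.toContinuousLinearMap, neg_ne_zero.2 hf', fun x hx => by
        simpa [hconst x hx] using h⟩

theorem exists_separating_hyperplane {V : Type*} [NormedAddCommGroup V] [NormedSpace ℝ V]
    [FiniteDimensional ℝ V] {A B : Set V} (hA : Convex ℝ A) (hB : Convex ℝ B) (hAne : A.Nonempty)
    (hBne : B.Nonempty) (hAB : Disjoint A B) :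
    ∃ (f : StrongDual ℝ V) (s : ℝ), f ≠ 0 ∧ (∀ x ∈ A, f x ≤ s) ∧ ∀ y ∈ B, s ≤ f y := by
  obtain ⟨f, hf, hle⟩ := exists_ne_zero_forall_le_zero (hA.sub hB) (hAne.sub hBne)
    hAB.zero_notMem_sub_set
  have hle' : ∀ x ∈ A, ∀ y ∈ B, f x ≤ f y := fun x hx y hy => by
    have := hle _ (sub_mem_sub hx hy)
    rw [map_sub] at this
    linarith
  obtain ⟨y₀, hy₀⟩ := hBne
  refine ⟨f, sSup (f '' A), hf, fun x hx => le_csSup ⟨f y₀, ?_⟩ (mem_image_of_mem f hx),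
    fun y hy => csSup_le (hAne.image f) ?_⟩
  · rintro _ ⟨x, hx, rfl⟩
    exact hle' x hx y₀ hy₀
  · rintro _ ⟨x, hx, rfl⟩
    exact hle' x hx y hy

/-- A finite partition of a finite-dimensional space into convex cells consists of Borel sets (a
single convex set need not be Borel). Off the hyperplanes that separate the cells pairwise, a cell
is an intersection of open half-spaces; on each of these hyperplanes the dimension drops. -/
theorem measurableSet_preimage_of_convex {ι : Type*} [Finite ι] (n : ℕ) :
    ∀ (V : Type) [NormedAddCommGroup V] [NormedSpace ℝ V] [FiniteDimensional ℝ V]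
      [MeasurableSpace V] [BorelSpace V], Module.finrank ℝ V = n → ∀ q : V → ι,
      (∀ i, Convex ℝ (q ⁻¹' {i})) → ∀ i, MeasurableSet (q ⁻¹' {i}) := by
  induction n with
  | zero =>
    intro V _ _ _ _ _ hV q _ i
    have := Module.finrank_zero_iff.1 hV
    exact (Set.subsingleton_of_subsingleton).measurableSet
  | succ n ih =>
    intro V _ _ _ _ _ hV q hq i
    rcases (q ⁻¹' {i}).eq_empty_or_nonempty with hi | hi
    · rw [hi]; exact MeasurableSet.empty
    let J := {j : ι // j ≠ i ∧ (q ⁻¹' {j}).Nonempty}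
    have hdisj : ∀ j : J, Disjoint (q ⁻¹' {i}) (q ⁻¹' {j.1}) := fun j =>
      Set.disjoint_left.2 fun x hx hy => j.2.1 ((show q x = j.1 from hy).symm.trans hx)
    choose f s hf hfi hfj using fun j : J =>
      exists_separating_hyperplane (hq i) (hq j) hi j.2.2 (hdisj j)
    -- the hyperplane is a translate of `ker (f j)`, to which the induction hypothesis applies
    have hplane : ∀ j : J, MeasurableSet (q ⁻¹' {i} ∩ {x | f j x = s j}) := fun j => by
      rcases ({x | f j x = s j} : Set V).eq_empty_or_nonempty with h | ⟨x₀, hx₀⟩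
      · rw [h, inter_empty]; exact MeasurableSet.empty
      have hrank : Module.finrank ℝ (LinearMap.ker (f j : V →ₗ[ℝ] ℝ)) = n := by
        have h1 := Module.Dual.finrank_ker_add_one_of_ne_zero (f := (f j : V →ₗ[ℝ] ℝ))
          (fun h => hf j (by ext x; exact LinearMap.congr_fun h x))
        omega
      let g : LinearMap.ker (f j : V →ₗ[ℝ] ℝ) → V := fun v => x₀ + v
      have hg : Topology.IsClosedEmbedding g :=
        (Homeomorph.addLeft x₀).isClosedEmbedding.comp
          (Submodule.closed_of_finiteDimensional _).isClosedEmbedding_subtypeVal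
      have hmeas := ih (LinearMap.ker (f j : V →ₗ[ℝ] ℝ)) hrank (q ∘ g) (fun k => by
        intro v hv w hw a b ha hb hab
        have h := hq k (show g v ∈ q ⁻¹' {k} from hv) (show g w ∈ q ⁻¹' {k} from hw) ha hb hab
        have heq : a • g v + b • g w = g (a • v + b • w) := by
          simp only [g, smul_add, Submodule.coe_add, Submodule.coe_smul]
          rw [add_add_add_comm, ← add_smul, hab, one_smul]
        rw [heq] at h
        exact h) i
      have himage : q ⁻¹' {i} ∩ {x | f j x = s j} = g '' ((q ∘ g) ⁻¹' {i}) := by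
        ext x
        constructor
        · rintro ⟨hx, hx'⟩
          refine ⟨⟨x - x₀, ?_⟩, ?_, ?_⟩
          · rw [LinearMap.mem_ker]
            simp only [ContinuousLinearMap.coe_coe, map_sub]
            rw [show f j x = s j from hx', show f j x₀ = s j from hx₀, sub_self]
          · simpa [g] using hx
          · simp [g]
        · rintro ⟨v, hv, rfl⟩
          refine ⟨hv, ?_⟩
          have := LinearMap.mem_ker.1 v.2
          simp only [ContinuousLinearMap.coe_coe] at this
          simp only [g, mem_ofPred_eq, map_add, this, add_zero]
          exact hx₀
      rw [himage]
      exact hg.measurableEmbedding.measurableSet_image.2 hmeas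
    have hcell : q ⁻¹' {i} =
        (⋂ j : J, {x | f j x < s j}) ∪ ⋃ j : J, (q ⁻¹' {i} ∩ {x | f j x = s j}) := by
      ext x
      simp only [mem_union, mem_iInter, mem_iUnion, mem_inter_iff, mem_ofPred_eq]
      constructor
      · intro hx
        by_cases h : ∃ j, f j x = s j
        · exact Or.inr (h.imp fun j hj => ⟨hx, hj⟩)
        · exact Or.inl fun j => lt_of_le_of_ne (hfi j x hx) fun hj => h ⟨j, hj⟩
      · rintro (h | ⟨j, hx, -⟩)
        · by_contra hx
          exact absurd (hfj ⟨q x, hx, x, rfl⟩ x rfl) (not_le.2 (h _))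
        · exact hx
    rw [hcell]
    exact (MeasurableSet.iInter fun j =>
      measurableSet_lt (f j).continuous.measurable measurable_const).union
      (MeasurableSet.iUnion hplane)

variable {d M : ℕ}

/-- The maps to the message set with convex cells, without the measurability requirement. -/
def convexPartitions (d M : ℕ) : Set (E d → Fin M) := {q | ∀ i, Convex ℝ (q ⁻¹' {i})}

theorem measurable_of_mem_convexPartitions {q : E d → Fin M} (hq : q ∈ convexPartitions d M) :
    Measurable q :=
  measurable_to_countable' fun i => measurableSet_preimage_of_convex _ (E d) rfl q hq i

/-- Convexity of the cells is a condition on triples of points, hence closed under pointwise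
limits; compactness is then Tychonoff's theorem for maps to a finite set. -/
theorem isCompact_convexPartitions (d M : ℕ) : IsCompact (convexPartitions d M) := by
  refine IsClosed.isCompact ?_
  have : convexPartitions d M = ⋂ (i : Fin M) (x : E d) (y : E d) (z ∈ segment ℝ x y),
      {q : E d → Fin M | q x = i → q y = i → q z = i} := by
    ext q
    simp only [convexPartitions, convex_iff_segment_subset, mem_ofPred_eq, mem_iInter]
    exact ⟨fun h i x y z hz hx hy => h i hx hy hz, fun h i x hx y hy z hz => h i x y z hz hx hy⟩
  rw [this]
  refine isClosed_iInter fun i => isClosed_iInter fun x => isClosed_iInter fun y =>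
    isClosed_iInter fun z => isClosed_iInter fun _ => ?_
  exact (isClosed_discrete {p : Fin M × Fin M × Fin M | p.1 = i → p.2.1 = i → p.2.2 = i}).preimage
    (f := fun q : E d → Fin M => (q x, q y, q z))
    ((continuous_apply x).prodMk ((continuous_apply y).prodMk (continuous_apply z)))

/-- Around an interior point of a cell, pointwise convergence of convex partitions is locally
uniform: a neighbourhood lies in a simplex, and it is enough to control the vertices. -/
theorem exists_nhds_forall_eventually_eq {q : E d → Fin M} {m : Fin M} {x : E d}
    (hx : x ∈ interior (q ⁻¹' {m})) :
    ∃ N ∈ 𝓝 x, ∀ᶠ q' in 𝓝[convexPartitions d M] q, ∀ y ∈ N, q' y = q y := by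
  obtain ⟨b, hb, hsub⟩ := exists_mem_interior_convexHull_affineBasis
    (mem_interior_iff_mem_nhds.1 hx)
  refine ⟨_, mem_interior_iff_mem_nhds.1 hb, ?_⟩
  have hv : ∀ k, q (b k) = m := fun k => hsub (subset_convexHull ℝ _ (mem_range_self k))
  have h1 : ∀ᶠ q' in 𝓝[convexPartitions d M] q, ∀ k, q' (b k) = m := by
    refine eventually_all.2 fun k => (Filter.Eventually.filter_mono nhdsWithin_le_nhds ?_)
    have ht : Tendsto (fun q' : E d → Fin M => q' (b k)) (𝓝 q) (𝓝 (q (b k))) :=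
      (continuous_apply (b k)).tendsto q
    rw [nhds_discrete (Fin M), hv k, tendsto_pure] at ht
    exact ht
  filter_upwards [h1, self_mem_nhdsWithin] with q' h2 h3 y hy
  have h4 : y ∈ q' ⁻¹' {m} :=
    convexHull_min (by rintro _ ⟨k, rfl⟩; exact h2 k) (h3 m) hy
  exact (show q' y = m from h4).trans (show q y = m from hsub hy).symm

theorem eventually_measure_ne_le (π : Measure (E d)) [IsFiniteMeasure π] (hπ : π ≪ volume)
    {q : E d → Fin M} (hq : q ∈ convexPartitions d M) {ε : ℝ≥0∞} (hε : ε ≠ 0) :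
    ∀ᶠ q' in 𝓝[convexPartitions d M] q, π {x | q' x ≠ q x} ≤ ε := by
  set O : Set (E d) := ⋃ m, interior (q ⁻¹' {m}) with hO
  have hOnull : π Oᶜ = 0 := by
    refine hπ (measure_mono_null (t := ⋃ m, frontier (q ⁻¹' {m})) (fun x hx => ?_)
      (measure_iUnion_null fun m => (hq m).addHaar_frontier volume))
    refine mem_iUnion.2 ⟨q x, subset_closure rfl, fun h => hx (mem_iUnion.2 ⟨_, h⟩)⟩
  obtain ⟨L, hLO, hL, hLε⟩ := (isOpen_iUnion fun m : Fin M =>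
    isOpen_interior (s := q ⁻¹' {m})).measurableSet.exists_isCompact_sdiff_lt (μ := π)
      (measure_ne_top _ _) hε
  have hev : ∀ᶠ q' in 𝓝[convexPartitions d M] q, ∀ y ∈ L, q' y = q y := by
    refine hL.induction_on
      (p := fun A : Set (E d) => ∀ᶠ q' in 𝓝[convexPartitions d M] q, ∀ y ∈ A, q' y = q y)
      (by simp) (fun A B hAB h => ?_) (fun A B hA hB => ?_) fun x hx => ?_
    · filter_upwards [h] with q' h' y hy
      exact h' y (hAB hy)
    · filter_upwards [hA, hB] with q' h1 h2 y hy
      exact hy.elim (h1 y) (h2 y)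
    · obtain ⟨m, hm⟩ := mem_iUnion.1 (hLO hx)
      obtain ⟨N, hN, h⟩ := exists_nhds_forall_eventually_eq hm
      exact ⟨N, mem_nhdsWithin_of_mem_nhds hN, h⟩
  filter_upwards [hev] with q' h
  calc π {x | q' x ≠ q x} ≤ π (Oᶜ ∪ O \ L) := measure_mono fun x hx => by
        by_cases hxO : x ∈ O
        · exact Or.inr ⟨hxO, fun hxL => hx (h x hxL)⟩
        · exact Or.inl hxO
    _ ≤ π Oᶜ + π (O \ L) := measure_union_le _ _
    _ ≤ ε := by rw [hOnull, zero_add]; exact hLε.le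

end ConvexPartitions

/-! ### Existence of optimal quantizers -/

section Minimiser

open Set Filter Topology

variable {d M : ℕ} {U : Type*} {S : SourceModel d} {c₀ : E d → U → ℝ} {T : ℕ} {B : ℝ}

theorem branchCost_restrict_le [Nonempty U] (hm : ∀ u, Measurable fun x => c₀ x u)
    (hc : ∀ x u, 0 ≤ c₀ x u) (hB : ∀ x u, c₀ x u ≤ B) (hM : 1 ≤ M) (n : ℕ)
    (π : Measure (E d)) [IsFiniteMeasure π] {A A' : Set (E d)} (hA : MeasurableSet A)
    (hA' : MeasurableSet A') :
    branchCost S M c₀ T n (π.restrict A) ≤ branchCost S M c₀ T n (π.restrict A') +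
      (n + 1) * (1 / (T : ℝ) * B) * π.real (A \ A') := by
  have h1 := branchCost_add_le (S := S) (T := T) hm hc hB hM n (ν := π.restrict (A ∩ A'))
    (ρ := π.restrict (A \ A'))
  have h2 := branchCost_mono (S := S) (T := T) hm hc hB hM n (ν := π.restrict (A' ∩ A))
    (ρ := π.restrict (A' \ A))
  rw [Measure.restrict_inter_add_sdiff _ hA', measureReal_restrict_apply_univ] at h1
  rw [Measure.restrict_inter_add_sdiff _ hA, inter_comm] at h2
  linarith

theorem continuousOn_sum_branchCost [Nonempty U] (hm : ∀ u, Measurable fun x => c₀ x u)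
    (hc : ∀ x u, 0 ≤ c₀ x u) (hB : ∀ x u, c₀ x u ≤ B) (hM : 1 ≤ M) (n : ℕ)
    (π : Measure (E d)) [IsFiniteMeasure π] (hπ : π ≪ volume) :
    ContinuousOn (fun q : E d → Fin M => ∑ m, branchCost S M c₀ T n (π.restrict (q ⁻¹' {m})))
      (convexPartitions d M) := by
  intro q hq
  have hB0 : 0 ≤ B := (hc 0 (Classical.arbitrary U)).trans (hB _ _)
  set L : ℝ := (n + 1) * (1 / (T : ℝ) * B) with hL
  have hL0 : 0 ≤ L := by positivity
  refine Metric.tendsto_nhds.2 fun ε hε => ?_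
  have hδ : 0 < ε / (M * L + 1) := by positivity
  filter_upwards [eventually_measure_ne_le π hπ hq (ENNReal.ofReal_pos.2 hδ).ne',
    self_mem_nhdsWithin] with q' hq' hq'c
  have hreal : π.real {x | q' x ≠ q x} ≤ ε / (M * L + 1) :=
    ENNReal.toReal_le_of_le_ofReal hδ.le hq'
  have hcell : ∀ {p : E d → Fin M}, p ∈ convexPartitions d M → ∀ m, MeasurableSet (p ⁻¹' {m}) :=
    fun hp m => measurable_of_mem_convexPartitions hp (measurableSet_singleton m)
  have hsum : ∀ p p' : E d → Fin M, p ∈ convexPartitions d M → p' ∈ convexPartitions d M →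
      {x | p x ≠ p' x} ⊆ {x | q' x ≠ q x} →
      ∑ m, branchCost S M c₀ T n (π.restrict (p ⁻¹' {m})) ≤
        ∑ m, branchCost S M c₀ T n (π.restrict (p' ⁻¹' {m})) + M * L * (ε / (M * L + 1)) := by
    intro p p' hp hp' hsub
    calc _ ≤ ∑ m : Fin M, (branchCost S M c₀ T n (π.restrict (p' ⁻¹' {m})) +
            L * (ε / (M * L + 1))) := by
          refine Finset.sum_le_sum fun m _ => ?_
          refine (branchCost_restrict_le hm hc hB hM n π (hcell hp m) (hcell hp' m)).trans ?_
          gcongr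
          refine (measureReal_mono fun x hx => ?_).trans hreal
          exact hsub fun h : p x = p' x => hx.2 (h.symm.trans hx.1)
      _ = _ := by
          rw [Finset.sum_add_distrib]
          simp [mul_assoc]
  have h1 := hsum q' q hq'c hq Subset.rfl
  have h2 := hsum q q' hq hq'c fun x hx => Ne.symm hx
  have h3 : M * L * (ε / (M * L + 1)) < ε := by
    rw [mul_div_assoc', div_lt_iff₀ (by positivity)]
    nlinarith
  rw [Real.dist_eq, abs_lt]
  constructor <;> linarith

/-- Against an absolutely continuous law an optimal quantizer with convex cells exists, by
compactness of the set of convex partitions under pointwise convergence. -/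
theorem exists_isMinimal_of_absolutelyContinuous [Nonempty U]
    (hm : ∀ u, Measurable fun x => c₀ x u)
    (hc : ∀ x u, 0 ≤ c₀ x u) (hB : ∀ x u, c₀ x u ≤ B) (hM : 1 ≤ M) (n : ℕ)
    (π : Measure (E d)) [IsFiniteMeasure π] (hπ : π ≪ volume) :
    ∃ Q ∈ convexQuantizers d M, ∀ Q' ∈ convexQuantizers d M,
      ∑ m, branchCost S M c₀ T n (π.restrict (Q.cell m)) ≤
        ∑ m, branchCost S M c₀ T n (π.restrict (Q'.cell m)) := by
  obtain ⟨Q₀, hQ₀⟩ := nonempty_convexQuantizers (d := d) hM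
  obtain ⟨q, hq, hmin⟩ := (isCompact_convexPartitions d M).exists_isMinOn ⟨Q₀.toFun, hQ₀⟩
    (continuousOn_sum_branchCost (S := S) (T := T) hm hc hB hM n π hπ)
  exact ⟨⟨q, measurable_of_mem_convexPartitions hq⟩, hq, fun Q' hQ' =>
    hmin (show Q'.toFun ∈ convexPartitions d M from hQ')⟩

/-- Against a point mass all quantizers have the same cost: only the cell of the atom counts. -/
theorem sum_branchCost_dirac (n : ℕ) (x₀ : E d) (Q : Quantizer d M) :
    ∑ m, branchCost S M c₀ T n ((Measure.dirac x₀).restrict (Q.cell m)) =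
      branchCost S M c₀ T n (Measure.dirac x₀) := by
  classical
  rw [Finset.sum_eq_single (Q.toFun x₀)]
  · rw [restrict_dirac' (Q.measurableSet_cell _), if_pos (show x₀ ∈ Q.cell (Q.toFun x₀) from rfl)]
  · intro m _ hm
    rw [restrict_dirac' (Q.measurableSet_cell _),
      if_neg (show x₀ ∉ Q.cell m from fun h => hm h.symm), branchCost_zero]
  · simp

end Minimiser

/-! ### Regular laws -/

section RegularLaws

open Set Filter Topology

variable {d M : ℕ} {U : Type*} {S : SourceModel d} {c₀ : E d → U → ℝ} {T : ℕ} {B C : ℝ} {K : ℝ≥0}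

/-- A Lipschitz density is recovered, with an explicit error, from the measures of small balls. -/
theorem abs_real_ball_sub_le {g : E d → ℝ} (hg0 : ∀ z, 0 ≤ g z) (hg : LipschitzWith K g) (z : E d)
    {r : ℝ} (hr : 0 < r) :
    |(volume.withDensity fun z => ENNReal.ofReal (g z)).real (Metric.ball z r) /
      (volume : Measure (E d)).real (Metric.ball z r) - g z| ≤ K * r := by
  set V := (volume : Measure (E d)).real (Metric.ball z r) with hV
  have hfin : (volume : Measure (E d)) (Metric.ball z r) < ∞ := measure_ball_lt_top
  have hV0 : 0 < V := ENNReal.toReal_pos (Metric.measure_ball_pos _ _ hr).ne' hfin.ne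
  have hdist : ∀ y ∈ Metric.ball z r, ‖g y - g z‖ ≤ K * r := fun y hy => by
    rw [← dist_eq_norm]
    exact (hg.dist_le_mul y z).trans (by gcongr; exact (Metric.mem_ball.1 hy).le)
  have hint : IntegrableOn g (Metric.ball z r) := by
    refine IntegrableOn.of_bound hfin hg.continuous.aestronglyMeasurable (‖g z‖ + K * r) ?_
    filter_upwards [ae_restrict_mem measurableSet_ball] with y hy
    calc ‖g y‖ = ‖g z + (g y - g z)‖ := by congr 1; ring
      _ ≤ _ := (norm_add_le _ _).trans (by gcongr; exact hdist y hy)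
  have h1 : (volume.withDensity fun z => ENNReal.ofReal (g z)).real (Metric.ball z r) =
      ∫ y in Metric.ball z r, g y := by
    rw [Measure.real, withDensity_apply _ measurableSet_ball,
      integral_eq_lintegral_of_nonneg_ae (.of_forall hg0) hg.continuous.aestronglyMeasurable]
  have h2 : ∫ y in Metric.ball z r, (g y - g z) = (∫ y in Metric.ball z r, g y) - V * g z := by
    rw [integral_sub hint (integrableOn_const hfin.ne)]
    simp [hV]
  have h3 := norm_setIntegral_le_of_norm_le_const hfin hdist
  rw [h2, Real.norm_eq_abs] at h3
  rw [h1, div_sub' hV0.ne', abs_div, abs_of_pos hV0, div_le_iff₀ hV0]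
  exact h3

/-- Measurability of the transition density in the conditioning variable is not assumed; it follows
from that of the kernel. -/
theorem measurable_density {φ : E d → E d → ℝ} (hφ : S.HasRegularDensity φ C K) (z : E d) :
    Measurable fun x => φ x z := by
  refine measurable_of_tendsto_metrizable (f := fun (n : ℕ) (x : E d) =>
    (S.kernel x).real (Metric.ball z (1 / ((n : ℝ) + 1))) /
      (volume : Measure (E d)).real (Metric.ball z (1 / ((n : ℝ) + 1)))) (fun n => ?_) ?_
  · exact (S.kernel.measurable_coe measurableSet_ball).ennreal_toReal.div_const _
  · refine tendsto_pi_nhds.2 fun x => tendsto_iff_dist_tendsto_zero.2 ?_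
    refine squeeze_zero (g := fun n : ℕ => K * (1 / ((n : ℝ) + 1))) (fun _ => dist_nonneg)
      (fun n => ?_) ?_
    · rw [S.kernel_apply, hφ.density, Real.dist_eq]
      exact abs_real_ball_sub_le (fun z => (hφ.pos x z).le) (hφ.lipschitz x) z (by positivity)
    · simpa using tendsto_one_div_add_atTop_nhds_zero_nat.const_mul (K : ℝ)

theorem bind_kernel_mem_regularLaws {φ : E d → E d → ℝ} (hφ : S.HasRegularDensity φ C K)
    (ρ : Measure (E d)) [IsProbabilityMeasure ρ] (π : ProbabilityMeasure (E d))
    (hπ : (π : Measure (E d)) = ρ.bind S.kernel) : π ∈ regularLaws d C K := by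
  have hint : ∀ z, Integrable (fun x => φ x z) ρ := fun z =>
    Integrable.of_bound (measurable_density hφ z).aestronglyMeasurable C
      (.of_forall fun x => by rw [Real.norm_of_nonneg (hφ.pos x z).le]; exact hφ.le x z)
  have hjoint : Measurable (Function.uncurry φ) :=
    (measurable_uncurry_of_continuous_of_measurable (u := fun z x => φ x z)
      (fun x => (hφ.lipschitz x).continuous) (measurable_density hφ)).comp measurable_swap
  refine ⟨fun z => ∫ x, φ x z ∂ρ, fun z => integral_nonneg fun x => (hφ.pos x z).le, fun z => ?_,
    LipschitzWith.of_dist_le_mul fun z z' => ?_, ?_⟩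
  · calc ∫ x, φ x z ∂ρ ≤ ∫ _, C ∂ρ := integral_mono (hint z) (integrable_const _) (hφ.le · z)
      _ = C := by simp
  · rw [dist_eq_norm, ← integral_sub (hint z) (hint z')]
    refine (norm_integral_le_of_norm_le_const (C := K * dist z z') (.of_forall fun x => ?_)).trans
      (by simp)
    rw [← dist_eq_norm]
    exact (hφ.lipschitz x).dist_le_mul z z'
  · rw [hπ]
    ext A hA
    rw [Measure.bind_apply hA S.kernel.aemeasurable, withDensity_apply _ hA]
    simp_rw [S.kernel_apply, hφ.density, withDensity_apply _ hA]
    rw [lintegral_lintegral_swap hjoint.ennreal_ofReal.aemeasurable]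
    refine lintegral_congr fun z => ?_
    rw [ofReal_integral_eq_lintegral_ofReal (hint z) (.of_forall fun x => (hφ.pos x z).le)]

theorem nextLaw_mem_regularLaws {φ : E d → E d → ℝ} (hφ : S.HasRegularDensity φ C K)
    (π : ProbabilityMeasure (E d)) (Q : Quantizer d M) (m : Fin M) :
    nextLaw S π Q m ∈ regularLaws d C K := by
  by_cases h : (π : Measure (E d)) (Q.cell m) = 0
  · exact bind_kernel_mem_regularLaws hφ π _ (congrArg Subtype.val (dif_pos h))
  · have := cond_isProbabilityMeasure h
    exact bind_kernel_mem_regularLaws hφ (ProbabilityTheory.cond (π : Measure (E d)) (Q.cell m)) _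
      (congrArg Subtype.val (dif_neg h))

theorem absolutelyContinuous_of_mem_regularLaws {π : ProbabilityMeasure (E d)}
    (hπ : π ∈ regularLaws d C K) : (π : Measure (E d)) ≪ volume := by
  obtain ⟨g, -, -, -, h⟩ := hπ
  rw [h]
  exact withDensity_absolutelyContinuous _ _

/-- Among measures with uniformly Lipschitz densities, weak convergence forces pointwise
convergence of the densities. -/
theorem tendsto_density {g : ProbabilityMeasure (E d) → E d → ℝ}
    (hg : ∀ π ∈ regularLaws d C K, (∀ z, 0 ≤ g π z) ∧ LipschitzWith K (g π) ∧
      (π : Measure (E d)) = volume.withDensity fun z => ENNReal.ofReal (g π z))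
    {π : ProbabilityMeasure (E d)} (hπ : π ∈ regularLaws d C K) (z : E d) :
    Tendsto (fun π' => g π' z) (𝓝[regularLaws d C K] π) (𝓝 (g π z)) := by
  refine Metric.tendsto_nhds.2 fun ε hε => ?_
  set r : ℝ := ε / (2 * K + 2) with hr
  have hr0 : 0 < r := by positivity
  set V := (volume : Measure (E d)).real (Metric.ball z r) with hV
  have hV0 : 0 < V :=
    ENNReal.toReal_pos (Metric.measure_ball_pos _ _ hr0).ne' measure_ball_lt_top.ne
  have hfr : (π : Measure (E d)) (frontier (Metric.ball z r)) = 0 :=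
    absolutelyContinuous_of_mem_regularLaws hπ (measure_mono_null Metric.frontier_ball_subset_sphere
      (Measure.addHaar_sphere_of_ne_zero _ _ hr0.ne'))
  have h1 : Tendsto (fun π' : ProbabilityMeasure (E d) => (π' : Measure (E d)) (Metric.ball z r))
      (𝓝[regularLaws d C K] π) (𝓝 ((π : Measure (E d)) (Metric.ball z r))) :=
    ProbabilityMeasure.tendsto_measure_of_null_frontier_of_tendsto'
      (tendsto_id.mono_left nhdsWithin_le_nhds) hfr
  have h2 : Tendsto (fun π' : ProbabilityMeasure (E d) =>
      (π' : Measure (E d)).real (Metric.ball z r) / V)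
      (𝓝[regularLaws d C K] π) (𝓝 ((π : Measure (E d)).real (Metric.ball z r) / V)) :=
    ((ENNReal.tendsto_toReal (measure_ne_top _ _)).comp h1).div_const V
  filter_upwards [Metric.tendsto_nhds.1 h2 r hr0, self_mem_nhdsWithin] with π' h3 h4
  have hball : ∀ π ∈ regularLaws d C K,
      |(π : Measure (E d)).real (Metric.ball z r) / V - g π z| ≤ K * r := fun π hπ => by
    have h := abs_real_ball_sub_le (hg π hπ).1 (hg π hπ).2.1 z hr0
    rwa [← (hg π hπ).2.2] at h
  have h5 := abs_le.1 (hball π hπ)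
  have h6 := abs_le.1 (hball π' h4)
  rw [Real.dist_eq] at h3 ⊢
  have h7 := abs_lt.1 h3
  have h8 : r * (2 * K + 2) = ε := div_mul_cancel₀ _ (by positivity)
  rw [abs_lt]
  constructor <;> nlinarith

theorem abs_unnormCost_sub_le [Nonempty U] (hm : ∀ u, Measurable fun x => c₀ x u)
    (hc : ∀ x u, 0 ≤ c₀ x u) (hB : ∀ x u, c₀ x u ≤ B) (hM : 1 ≤ M) (n : ℕ)
    {π π' : Measure (E d)} [IsProbabilityMeasure π] [IsProbabilityMeasure π'] {g g' : E d → ℝ}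
    (hg : Measurable g) (hg' : Measurable g') (hg0 : ∀ z, 0 ≤ g z) (hg0' : ∀ z, 0 ≤ g' z)
    (hπ : π = volume.withDensity fun z => ENNReal.ofReal (g z))
    (hπ' : π' = volume.withDensity fun z => ENNReal.ofReal (g' z)) :
    |unnormCost S M c₀ T n π' - unnormCost S M c₀ T n π| ≤
      n * (1 / (T : ℝ) * B) * ∫ z, max (g z - g' z) 0 := by
  -- `κ` is the common part of both measures; the two remainders have the same mass
  set κ := (volume : Measure (E d)).withDensity fun z => ENNReal.ofReal (min (g z) (g' z)) with hκ
  have hsplit : ∀ {f f' : E d → ℝ}, Measurable f → Measurable f' → (∀ z, 0 ≤ f z) →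
      (∀ z, 0 ≤ f' z) →
      ((volume : Measure (E d)).withDensity fun z => ENNReal.ofReal (min (f z) (f' z))) +
        (volume.withDensity fun z => ENNReal.ofReal (max (f z - f' z) 0)) =
      volume.withDensity fun z => ENNReal.ofReal (f z) := fun hf hf' h0 h0' => by
    rw [← withDensity_add_left (hf.min hf').ennreal_ofReal]
    congr 1
    ext z
    rw [Pi.add_apply, ← ENNReal.ofReal_add (le_min (h0 z) (h0' z)) (le_max_right _ _)]
    congr 1
    rcases le_total (_ : ℝ) (_ : ℝ) with h | h
    · rw [min_eq_left h, max_eq_right (sub_nonpos.2 h), add_zero]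
    · rw [min_eq_right h, max_eq_left (sub_nonneg.2 h)]; ring
  set ρ := (volume : Measure (E d)).withDensity fun z => ENNReal.ofReal (max (g z - g' z) 0)
    with hρ
  set ρ' := (volume : Measure (E d)).withDensity fun z => ENNReal.ofReal (max (g' z - g z) 0)
    with hρ'
  have h1 : κ + ρ = π := by rw [hπ]; exact hsplit hg hg' hg0 hg0'
  have h2 : κ + ρ' = π' := by
    rw [hπ', hκ]; simp_rw [min_comm (g _)]; exact hsplit hg' hg hg0' hg0
  have hκfin : IsFiniteMeasure κ := ⟨lt_of_le_of_lt
    ((Measure.le_add_right le_rfl : κ ≤ κ + ρ) Set.univ) (h1 ▸ measure_lt_top _ _)⟩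
  have hρfin : IsFiniteMeasure ρ := ⟨lt_of_le_of_lt
    ((Measure.le_add_left le_rfl : ρ ≤ κ + ρ) Set.univ) (h1 ▸ measure_lt_top _ _)⟩
  have hρfin' : IsFiniteMeasure ρ' := ⟨lt_of_le_of_lt
    ((Measure.le_add_left le_rfl : ρ' ≤ κ + ρ') Set.univ) (h2 ▸ measure_lt_top _ _)⟩
  have hmass : ρ'.real univ = ρ.real univ := by
    have e1 : (κ + ρ).real univ = 1 := by rw [h1]; simp
    have e2 : (κ + ρ').real univ = 1 := by rw [h2]; simp
    rw [measureReal_add_apply] at e1 e2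
    linarith
  have hρint : ρ.real univ = ∫ z, max (g z - g' z) 0 := by
    rw [hρ, Measure.real, withDensity_apply _ MeasurableSet.univ, Measure.restrict_univ,
      integral_eq_lintegral_of_nonneg_ae (f := fun z => max (g z - g' z) 0)
        (.of_forall fun z => le_max_right _ _)
        ((hg.sub hg').max measurable_const).aestronglyMeasurable]
  have u1 := unnormCost_add_le (S := S) (T := T) hm hc hB hM n κ ρ
  have u2 := unnormCost_add_le (S := S) (T := T) hm hc hB hM n κ ρ'
  have l1 := unnormCost_mono (S := S) (T := T) hm hc hB hM n κ ρ
  have l2 := unnormCost_mono (S := S) (T := T) hm hc hB hM n κ ρ'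
  rw [h1] at u1 l1
  rw [h2] at u2 l2
  rw [hmass] at u2
  rw [← hρint, abs_le]
  constructor <;> linarith

/-- The costs are Lipschitz in total variation, and on regular laws weak convergence implies
convergence in total variation, by Scheffé's lemma. -/
theorem continuousOn_costToGo [Nonempty U] (hm : ∀ u, Measurable fun x => c₀ x u)
    (hc : ∀ x u, 0 ≤ c₀ x u) (hB : ∀ x u, c₀ x u ≤ B) (hM : 1 ≤ M) (n : ℕ) :
    ContinuousOn (costToGo S M c₀ T n) (regularLaws d C K) := by
  intro π hπ
  have hex : ∀ π : ProbabilityMeasure (E d), ∃ g : E d → ℝ, π ∈ regularLaws d C K →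
      (∀ z, 0 ≤ g z) ∧ LipschitzWith K g ∧
      (π : Measure (E d)) = volume.withDensity fun z => ENNReal.ofReal (g z) := fun π => by
    by_cases h : π ∈ regularLaws d C K
    · obtain ⟨g, h0, -, h1, h2⟩ := h
      exact ⟨g, fun _ => ⟨h0, h1, h2⟩⟩
    · exact ⟨0, fun h' => absurd h' h⟩
  choose g hg using hex
  have hgm : ∀ π ∈ regularLaws d C K, Measurable (g π) := fun π hπ =>
    (hg π hπ).2.1.continuous.measurable
  have hgint : Integrable (g π) := by
    refine ⟨(hgm π hπ).aestronglyMeasurable, ?_⟩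
    rw [hasFiniteIntegral_iff_ofReal (.of_forall (hg π hπ).1)]
    have h : (π : Measure (E d)) univ < ∞ := measure_lt_top _ _
    rwa [(hg π hπ).2.2, withDensity_apply _ MeasurableSet.univ, Measure.restrict_univ] at h
  have hL1 : Tendsto (fun π' => ∫ z, max (g π z - g π' z) 0) (𝓝[regularLaws d C K] π) (𝓝 0) := by
    have h := tendsto_integral_filter_of_dominated_convergence (μ := (volume : Measure (E d)))
      (l := 𝓝[regularLaws d C K] π) (F := fun π' z => max (g π z - g π' z) 0)
      (f := fun z => max (g π z - g π z) 0) (g π) ?_ ?_ hgint (.of_forall fun z => ?_)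
    · simpa using h
    · filter_upwards [self_mem_nhdsWithin] with π' hπ'
      exact (((hgm π hπ).sub (hgm π' hπ')).max measurable_const).aestronglyMeasurable
    · filter_upwards [self_mem_nhdsWithin] with π' hπ'
      refine .of_forall fun z => ?_
      rw [Real.norm_of_nonneg (le_max_right _ _)]
      exact max_le (sub_le_self _ ((hg π' hπ').1 z)) ((hg π hπ).1 z)
    · exact (tendsto_const_nhds.sub (tendsto_density hg hπ z)).max tendsto_const_nhds
  refine tendsto_iff_dist_tendsto_zero.2 (squeeze_zero' (.of_forall fun _ => dist_nonneg) ?_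
    (mul_zero (n * (1 / (T : ℝ) * B)) ▸ hL1.const_mul _))
  filter_upwards [self_mem_nhdsWithin] with π' hπ'
  rw [Real.dist_eq, ← unnormCost_coe, ← unnormCost_coe]
  exact abs_unnormCost_sub_le hm hc hB hM n (hgm π hπ) (hgm π' hπ') (hg π hπ).1 (hg π' hπ').1
    (hg π hπ).2.2 (hg π' hπ').2.2

end RegularLaws

/-! ### The state law on the event that given messages have been sent -/

section StateLaw

open Set Filter Topology

variable {d M : ℕ} {Ω : Type*}

theorem measurable_snoc (t : ℕ) : Measurable fun p : (Fin t → Fin M) × Fin M =>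
    (Fin.snoc (α := fun _ => Fin M) p.1 p.2 : Fin (t + 1) → Fin M) :=
  .of_discrete

theorem measurable_messages {mΩ : MeasurableSpace Ω} (η : Policy d M) {X : ℕ → Ω → E d} :
    ∀ t : ℕ, (∀ s < t, Measurable (X s)) →
      Measurable fun ω => η.messages (fun s => X s ω) t
  | 0, _ => measurable_const
  | t + 1, hX => by
    have h1 := measurable_messages η t fun s hs => hX s (by omega)
    have h2 : Measurable fun ω => (fun i : Fin (t + 1) => X i ω) :=
      measurable_pi_iff.2 fun i => hX i i.2
    exact (measurable_snoc t).comp (h1.prodMk ((η.measurable t).comp (h1.prodMk h2)))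

variable [MeasurableSpace Ω] {S : SourceModel d} {π₀ : ProbabilityMeasure (E d)}
  {μ : Measure Ω} {X W : ℕ → Ω → E d}

theorem SourceModel.IsDrivenBy.measurable (hX : S.IsDrivenBy π₀ μ X W) :
    ∀ t, Measurable (X t)
  | 0 => hX.measurable_init
  | t + 1 => by
    rw [show X (t + 1) = fun ω => S.f (X t ω) (W t ω) from funext (hX.step t)]
    exact S.measurable_f.comp ((hX.measurable t).prodMk (hX.measurable_noise t))

/-- The initial state together with the noise variables before time `t`. -/
def past (X W : ℕ → Ω → E d) (t : ℕ) (ω : Ω) : E d × (Finset.range t → E d) :=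
  (X 0 ω, fun s => W s ω)

theorem SourceModel.IsDrivenBy.measurable_comap_past (hX : S.IsDrivenBy π₀ μ X W) (t : ℕ) :
    ∀ s ≤ t, Measurable[MeasurableSpace.comap (past X W t) inferInstance] (X s)
  | 0, _ => measurable_fst.comp (comap_measurable (past X W t))
  | s + 1, hs => by
    rw [show X (s + 1) = fun ω => S.f (X s ω) (W s ω) from funext (hX.step s)]
    have hW : Measurable[MeasurableSpace.comap (past X W t) inferInstance] (W s) :=
      ((measurable_pi_apply (⟨s, Finset.mem_range.2 hs⟩ : Finset.range t)).comp
        measurable_snd).comp (comap_measurable (past X W t))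
    exact S.measurable_f.comp ((hX.measurable_comap_past t s (by omega)).prodMk hW)

theorem SourceModel.IsDrivenBy.measurable_past (hX : S.IsDrivenBy π₀ μ X W) (t : ℕ) :
    Measurable (past X W t) :=
  hX.measurable_init.prodMk (measurable_pi_iff.2 fun s => hX.measurable_noise s)

/-- The noise at time `t` is independent of the initial state and the earlier noise. -/
theorem SourceModel.IsDrivenBy.indepFun_past [IsProbabilityMeasure μ]
    (hX : S.IsDrivenBy π₀ μ X W) (t : ℕ) : IndepFun (past X W t) (W t) μ := by
  let W' : Ω → (Finset.range t → E d) := fun ω s => W s ω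
  have hW' : Measurable W' := measurable_pi_iff.2 fun s => hX.measurable_noise s
  have hWt := hX.measurable_noise t
  have hX0 := hX.measurable_init
  have h1 : IndepFun W' (W t) μ :=
    (hX.iIndep_noise.indepFun_finset (Finset.range t) {t} (by simp) hX.measurable_noise).comp
      (φ := id) (ψ := fun w : ({t} : Finset ℕ) → E d => w ⟨t, by simp⟩) measurable_id
      (by fun_prop)
  have h2 : IndepFun (X 0) (fun ω => (W' ω, W t ω)) μ :=
    hX.indep_init.comp (φ := id) (ψ := fun w : ℕ → E d => ((fun s : Finset.range t => w s), w t))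
      measurable_id (by fun_prop)
  have h3 : IndepFun (X 0) W' μ := h2.comp (φ := id) (ψ := Prod.fst) measurable_id measurable_fst
  rw [indepFun_iff_map_prod_eq_prod_map_map hX0.aemeasurable (hW'.prodMk hWt).aemeasurable,
    (indepFun_iff_map_prod_eq_prod_map_map hW'.aemeasurable hWt.aemeasurable).1 h1,
    ← Measure.prodAssoc_prod,
    ← (indepFun_iff_map_prod_eq_prod_map_map hX0.aemeasurable hW'.aemeasurable).1 h3] at h2
  have : IsFiniteMeasure (μ.map (past X W t)) := inferInstance
  rw [indepFun_iff_map_prod_eq_prod_map_map (hX.measurable_past t).aemeasurable hWt.aemeasurable]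
  refine (MeasurableEquiv.prodAssoc (α := E d) (β := Finset.range t → E d)
    (γ := E d)).map_measurableEquiv_injective ?_
  refine Eq.trans ?_ h2
  rw [Measure.map_map (MeasurableEquiv.measurable _) ((hX.measurable_past t).prodMk hWt)]
  rfl

theorem map_prod_uncurry (S : SourceModel d) (ν : Measure (E d)) [IsFiniteMeasure ν] :
    (ν.prod (S.noise : Measure (E d))).map (Function.uncurry S.f) = ν.bind S.kernel := by
  ext A hA
  rw [Measure.map_apply S.measurable_f hA, Measure.prod_apply (S.measurable_f hA),
    Measure.bind_apply hA S.kernel.aemeasurable]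
  refine lintegral_congr fun x => ?_
  rw [S.kernel_apply, Measure.map_apply (show Measurable (S.f x) from
    S.measurable_f.comp measurable_prodMk_left) hA]
  rfl

/-- The law of `x_t` on the event that the messages before time `t` are `q`; its mass is the
probability of this event. -/
noncomputable def priorLaw (μ : Measure Ω) (X : ℕ → Ω → E d) (η : Policy d M) (t : ℕ)
    (q : Fin t → Fin M) : Measure (E d) :=
  (μ.restrict {ω | η.messages (fun s => X s ω) t = q}).map (X t)

/-- The law of `x_t` on the event that the messages up to and including time `t` are `q`. -/
noncomputable def posteriorLaw (μ : Measure Ω) (X : ℕ → Ω → E d) (η : Policy d M) (t : ℕ)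
    (q : Fin (t + 1) → Fin M) : Measure (E d) :=
  (μ.restrict {ω | η.messages (fun s => X s ω) (t + 1) = q}).map (X t)

instance [IsFiniteMeasure μ] (η : Policy d M) (t : ℕ) (q : Fin t → Fin M) :
    IsFiniteMeasure (priorLaw μ X η t q) := by
  unfold priorLaw; infer_instance

instance [IsFiniteMeasure μ] (η : Policy d M) (t : ℕ) (q : Fin (t + 1) → Fin M) :
    IsFiniteMeasure (posteriorLaw μ X η t q) := by
  unfold posteriorLaw; infer_instance

theorem SourceModel.IsDrivenBy.measurableSet_messages_eq (hX : S.IsDrivenBy π₀ μ X W)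
    (η : Policy d M) (t : ℕ) (q : Fin t → Fin M) :
    MeasurableSet {ω | η.messages (fun s => X s ω) t = q} :=
  measurable_messages η t (fun s _ => hX.measurable s) (measurableSet_singleton q)

theorem SourceModel.IsDrivenBy.priorLaw_zero (hX : S.IsDrivenBy π₀ μ X W) (η : Policy d M)
    (q : Fin 0 → Fin M) : priorLaw μ X η 0 q = π₀ := by
  have : {ω | η.messages (fun s => X s ω) 0 = q} = univ :=
    eq_univ_of_forall fun ω => Subsingleton.elim _ _
  rw [priorLaw, this, Measure.restrict_univ, hX.map_init]

/-- The prediction step: the noise is independent of the past, so the state law is transported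
by the kernel. -/
theorem SourceModel.IsDrivenBy.priorLaw_succ [IsProbabilityMeasure μ]
    (hX : S.IsDrivenBy π₀ μ X W) (η : Policy d M) (t : ℕ) (q : Fin (t + 1) → Fin M) :
    priorLaw μ X η (t + 1) q = (posteriorLaw μ X η t q).bind S.kernel := by
  set A : Set Ω := {ω | η.messages (fun s => X s ω) (t + 1) = q} with hA
  have hXW := (hX.measurable t).prodMk (hX.measurable_noise t)
  have hprod : (μ.restrict A).map (fun ω => (X t ω, W t ω)) =
      ((μ.restrict A).map (X t)).prod (S.noise : Measure (E d)) := by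
    refine (Measure.prod_eq fun B B' hB hB' => ?_).symm
    have hpast : MeasurableSet[MeasurableSpace.comap (past X W t) inferInstance]
        (X t ⁻¹' B ∩ A) :=
      @MeasurableSet.inter _ (MeasurableSpace.comap (past X W t) inferInstance) _ _
        (hX.measurable_comap_past t t le_rfl hB)
        (@measurable_messages d M Ω (MeasurableSpace.comap (past X W t) inferInstance) η X (t + 1)
          (fun s hs => hX.measurable_comap_past t s (by omega)) _ (measurableSet_singleton q))
    obtain ⟨D, hD, hDeq⟩ := hpast
    rw [Measure.map_apply hXW (hB.prod hB'), Measure.map_apply (hX.measurable t) hB,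
      Measure.restrict_apply (hXW (hB.prod hB')), Measure.restrict_apply (hX.measurable t hB),
      ← hX.map_noise t, Measure.map_apply (hX.measurable_noise t) hB', ← hDeq,
      ← (hX.indepFun_past t).measure_inter_preimage_eq_mul _ _ hD hB', hDeq]
    congr 1
    ext ω
    simp only [mem_inter_iff, mem_preimage, mem_prod]
    tauto
  rw [priorLaw, posteriorLaw, ← map_prod_uncurry, ← hprod, Measure.map_map S.measurable_f hXW]
  congr 1
  exact funext (hX.step t)

/-- At each time the encoder applies to the current state a quantizer `Q t q` chosen from the
previous messages `q`, almost surely. -/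
def UsesQuantizers (μ : Measure Ω) (X : ℕ → Ω → E d) (η : Policy d M)
    (Q : (t : ℕ) → (Fin t → Fin M) → Quantizer d M) : Prop :=
  ∀ t, ∀ᵐ ω ∂μ, η.enc t (η.messages (fun s => X s ω) t) (fun i => X i ω) =
    (Q t (η.messages (fun s => X s ω) t)).toFun (X t ω)

/-- The update step: a new message restricts the state law to the corresponding cell. -/
theorem UsesQuantizers.posteriorLaw_snoc {η : Policy d M}
    {Q : (t : ℕ) → (Fin t → Fin M) → Quantizer d M} (hQ : UsesQuantizers μ X η Q)
    (hX : S.IsDrivenBy π₀ μ X W) (t : ℕ) (q : Fin t → Fin M) (m : Fin M) :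
    posteriorLaw μ X η t (Fin.snoc (α := fun _ => Fin M) q m) =
      (priorLaw μ X η t q).restrict ((Q t q).cell m) := by
  ext A hA
  have hcell := (Q t q).measurableSet_cell m
  rw [posteriorLaw, priorLaw, Measure.restrict_apply hA, Measure.map_apply (hX.measurable t) hA,
    Measure.map_apply (hX.measurable t) (hA.inter hcell),
    Measure.restrict_apply (hX.measurable t hA),
    Measure.restrict_apply (hX.measurable t (hA.inter hcell))]
  refine measure_congr ?_
  filter_upwards [hQ t] with ω hω
  refine propext ?_
  have hsnoc : η.messages (fun s => X s ω) (t + 1) = Fin.snoc (α := fun _ => Fin M) q m ↔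
      η.messages (fun s => X s ω) t = q ∧ (Q t q).toFun (X t ω) = m := by
    rw [Policy.messages, hω]
    constructor
    · intro h
      have h1 := congrArg (Fin.init (α := fun _ => Fin M)) h
      have h2 := congrFun h (Fin.last t)
      rw [Fin.init_snoc, Fin.init_snoc] at h1
      rw [Fin.snoc_last, Fin.snoc_last, h1] at h2
      exact ⟨h1, h2⟩
    · rintro ⟨rfl, rfl⟩
      rfl
  change (X t ω ∈ A ∧ η.messages (fun s => X s ω) (t + 1) = Fin.snoc (α := fun _ => Fin M) q m) ↔
    ((X t ω ∈ A ∧ (Q t q).toFun (X t ω) = m) ∧ η.messages (fun s => X s ω) t = q)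
  rw [hsnoc]
  tauto

theorem sum_snoc {t : ℕ} (F : (Fin (t + 1) → Fin M) → ℝ) :
    ∑ q, F q = ∑ q : Fin t → Fin M, ∑ m, F (Fin.snoc (α := fun _ => Fin M) q m) := by
  rw [← (Fin.snocEquiv fun _ : Fin (t + 1) => Fin M).sum_comp, Fintype.sum_prod_type_right]
  rfl

/-- `condDistrib` is determined at messages of positive probability only: there it is the normalised
law of the state. -/
theorem SourceModel.IsDrivenBy.condDistrib_eq [IsProbabilityMeasure μ]
    (hX : S.IsDrivenBy π₀ μ X W) (η : Policy d M) (t : ℕ) (q : Fin t → Fin M)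
    (hq : μ {ω | η.messages (fun s => X s ω) t = q} ≠ 0) (a : ℝ≥0) (π : ProbabilityMeasure (E d))
    (hπ : priorLaw μ X η t q = a • (π : Measure (E d))) :
    condDistrib (X t) (fun ω => η.messages (fun s => X s ω) t) μ q = π := by
  have hmsg := measurable_messages η t fun s _ => hX.measurable s
  have hmass : μ {ω | η.messages (fun s => X s ω) t = q} = a := by
    have h := congrArg (fun ν : Measure (E d) => ν univ) hπ
    simpa [priorLaw, Measure.map_apply (hX.measurable t)] using h
  have hmap : μ.map (fun ω => η.messages (fun s => X s ω) t) {q} = a := by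
    rw [Measure.map_apply hmsg (measurableSet_singleton q)]
    exact hmass
  ext A hA
  rw [condDistrib_apply_of_ne_zero (hX.measurable t) q (by rwa [hmap, ← hmass]) A, hmap,
    Measure.map_apply (hmsg.prodMk (hX.measurable t)) ((measurableSet_singleton q).prod hA)]
  have h := congrArg (fun ν : Measure (E d) => ν A) hπ
  simp only [priorLaw, Measure.map_apply (hX.measurable t) hA,
    Measure.restrict_apply (hX.measurable t hA)] at h
  have hset : (fun ω => (η.messages (fun s => X s ω) t, X t ω)) ⁻¹' ({q} ×ˢ A) =
      X t ⁻¹' A ∩ {ω | η.messages (fun s => X s ω) t = q} := by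
    ext ω
    exact and_comm
  rw [hset, h, Measure.smul_apply, ENNReal.smul_def, smul_eq_mul, ← mul_assoc,
    ENNReal.inv_mul_cancel (by rwa [← hmass]) ENNReal.coe_ne_top, one_mul]

end StateLaw

/-! ### The cost of a policy -/

section Cost

open Set Filter Topology

variable {d M : ℕ} {Ω U : Type*} [MeasurableSpace Ω] {S : SourceModel d}
  {π₀ : ProbabilityMeasure (E d)} {μ : Measure Ω} {X W : ℕ → Ω → E d} {c₀ : E d → U → ℝ} {B : ℝ}
  {T : ℕ}

theorem exists_integral_eq_actionCost [TopologicalSpace U] [FirstCountableTopology U]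
    [CompactSpace U] [Nonempty U]
    (hcont : Continuous (Function.uncurry c₀)) (hc : ∀ x u, 0 ≤ c₀ x u) (hB : ∀ x u, c₀ x u ≤ B)
    (ν : Measure (E d)) [IsFiniteMeasure ν] : ∃ u, ∫ x, c₀ x u ∂ν = actionCost c₀ ν := by
  have h : Continuous fun u => ∫ x, c₀ x u ∂ν := by
    refine continuous_of_dominated (bound := fun _ => B) (fun u => ?_)
      (fun u => .of_forall fun x => ?_) (integrable_const _) (.of_forall fun x => ?_)
    · exact (hcont.comp (by fun_prop : Continuous fun x : E d => (x, u))).aestronglyMeasurable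
    · rw [Real.norm_of_nonneg (hc x u)]; exact hB x u
    · exact hcont.comp (by fun_prop : Continuous fun u : U => (x, u))
  obtain ⟨u, -, hu⟩ := isCompact_univ.exists_isMinOn univ_nonempty h.continuousOn
  exact ⟨u, le_antisymm (le_ciInf fun v => hu (mem_univ v)) (actionCost_le hc ν u)⟩

theorem averageCost_eq [IsProbabilityMeasure μ] (hX : S.IsDrivenBy π₀ μ X W)
    (hm : ∀ u, Measurable fun x => c₀ x u) (hc : ∀ x u, 0 ≤ c₀ x u) (hB : ∀ x u, c₀ x u ≤ B)
    (η : Policy d M) (γ : Receiver M U) :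
    averageCost μ X c₀ T η γ = ∑ t ∈ Finset.range T, (1 / (T : ℝ)) *
      ∑ q, ∫ x, c₀ x (γ t q) ∂(posteriorLaw μ X η t q) := by
  have hset := fun t => hX.measurableSet_messages_eq η (t + 1)
  have huniv : ∀ t, ⋃ q, {ω | η.messages (fun s => X s ω) (t + 1) = q} = univ := fun t =>
    eq_univ_of_forall fun ω => mem_iUnion.2 ⟨_, rfl⟩
  have hon : ∀ t q, IntegrableOn
      (fun ω => c₀ (X t ω) (γ t (η.messages (fun s => X s ω) (t + 1))))
      {ω | η.messages (fun s => X s ω) (t + 1) = q} μ := fun t q => by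
    refine IntegrableOn.congr_fun (f := fun ω => c₀ (X t ω) (γ t q)) ?_
      (fun ω hω => by simp only [show η.messages (fun s => X s ω) (t + 1) = q from hω]) (hset t q)
    refine Integrable.of_bound ((hm _).comp (hX.measurable t)).aestronglyMeasurable B
      (.of_forall fun ω => ?_)
    rw [Real.norm_of_nonneg (hc _ _)]
    exact hB _ _
  have hint : ∀ t, Integrable
      (fun ω => c₀ (X t ω) (γ t (η.messages (fun s => X s ω) (t + 1)))) μ := fun t => by
    rw [← integrableOn_univ, ← huniv t, integrableOn_finite_iUnion]
    exact hon t
  rw [averageCost, integral_const_mul, integral_finsetSum _ fun t _ => hint t, Finset.mul_sum]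
  refine Finset.sum_congr rfl fun t _ => ?_
  rw [← setIntegral_univ, ← huniv t, integral_iUnion_fintype (hset t)
    (fun q q' hqq' => Set.disjoint_left.2 fun ω hω hω' =>
      hqq' (Eq.trans (Eq.symm hω) hω')) (hon t)]
  congr 1
  refine Finset.sum_congr rfl fun q _ => ?_
  rw [posteriorLaw, integral_map (hX.measurable t).aemeasurable (hm _).aestronglyMeasurable]
  exact setIntegral_congr_fun (hset t q) fun ω hω => by
    simp only [show η.messages (fun s => X s ω) (t + 1) = q from hω]

/-- The optimal receiver minimises separately after every sequence of messages. -/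
theorem policyCost_eq [IsProbabilityMeasure μ] [TopologicalSpace U] [FirstCountableTopology U]
    [CompactSpace U] [Nonempty U] (hX : S.IsDrivenBy π₀ μ X W)
    (hcont : Continuous (Function.uncurry c₀)) (hm : ∀ u, Measurable fun x => c₀ x u)
    (hc : ∀ x u, 0 ≤ c₀ x u) (hB : ∀ x u, c₀ x u ≤ B) (η : Policy d M) :
    policyCost μ X c₀ T η = ∑ t ∈ Finset.range T, (1 / (T : ℝ)) *
      ∑ q, actionCost c₀ (posteriorLaw μ X η t q) := by
  choose γ hγ using fun (t : ℕ) (q : Fin (t + 1) → Fin M) =>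
    exists_integral_eq_actionCost hcont hc hB (posteriorLaw μ X η t q)
  have hle : ∀ γ : Receiver M U, ∑ t ∈ Finset.range T, (1 / (T : ℝ)) *
      ∑ q, actionCost c₀ (posteriorLaw μ X η t q) ≤ averageCost μ X c₀ T η γ := fun γ => by
    rw [averageCost_eq hX hm hc hB]
    gcongr with t _ q
    exact actionCost_le hc _ _
  have hne : Nonempty (Receiver M U) := ⟨γ⟩
  refine le_antisymm ((ciInf_le ⟨_, by rintro _ ⟨γ, rfl⟩; exact hle γ⟩ γ).trans_eq ?_)
    (le_ciInf hle)
  rw [averageCost_eq hX hm hc hB]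
  simp_rw [hγ]

theorem UsesQuantizers.sum_branchCost_eq [IsProbabilityMeasure μ] {η : Policy d M}
    {Q : (t : ℕ) → (Fin t → Fin M) → Quantizer d M} (hQ : UsesQuantizers μ X η Q)
    (hX : S.IsDrivenBy π₀ μ X W) (t n : ℕ) :
    ∑ q, ∑ m, branchCost S M c₀ T n ((priorLaw μ X η t q).restrict ((Q t q).cell m)) =
      (1 / (T : ℝ)) * ∑ q, actionCost c₀ (posteriorLaw μ X η t q) +
        ∑ q, unnormCost S M c₀ T n (priorLaw μ X η (t + 1) q) := by
  rw [sum_snoc, sum_snoc, Finset.mul_sum, ← Finset.sum_add_distrib]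
  refine Finset.sum_congr rfl fun q _ => ?_
  rw [Finset.mul_sum, ← Finset.sum_add_distrib]
  refine Finset.sum_congr rfl fun m _ => ?_
  rw [hX.priorLaw_succ, hQ.posteriorLaw_snoc hX, branchCost]

theorem SourceModel.IsDrivenBy.sum_priorLaw_zero (hX : S.IsDrivenBy π₀ μ X W) (η : Policy d M) :
    ∑ q, unnormCost S M c₀ T T (priorLaw μ X η 0 q) = value S M c₀ T 0 π₀ := by
  simp only [hX.priorLaw_zero, unnormCost_coe]
  simp [value]

/-- Verification, lower bound: a policy with convex quantizers costs at least the value. -/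
theorem UsesQuantizers.value_le [IsProbabilityMeasure μ] [TopologicalSpace U]
    [FirstCountableTopology U] [CompactSpace U] [Nonempty U] {η : Policy d M}
    {Q : (t : ℕ) → (Fin t → Fin M) → Quantizer d M} (hQ : UsesQuantizers μ X η Q)
    (hQc : ∀ t q, Q t q ∈ convexQuantizers d M) (hX : S.IsDrivenBy π₀ μ X W)
    (hcont : Continuous (Function.uncurry c₀)) (hm : ∀ u, Measurable fun x => c₀ x u)
    (hc : ∀ x u, 0 ≤ c₀ x u) (hB : ∀ x u, c₀ x u ≤ B) :
    value S M c₀ T 0 π₀ ≤ policyCost μ X c₀ T η := by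
  have key : ∀ k ≤ T, value S M c₀ T 0 π₀ ≤ ∑ t ∈ Finset.range k, (1 / (T : ℝ)) *
      ∑ q, actionCost c₀ (posteriorLaw μ X η t q) +
        ∑ q, unnormCost S M c₀ T (T - k) (priorLaw μ X η k q) := by
    intro k
    induction k with
    | zero => intro _; simp [← hX.sum_priorLaw_zero η]
    | succ k ih =>
      intro hk
      refine (ih (by omega)).trans ?_
      rw [Finset.sum_range_succ, add_assoc, ← hQ.sum_branchCost_eq hX,
        show T - k = T - (k + 1) + 1 by omega]
      gcongr with q
      exact unnormCost_le hc _ _ (hQc k q)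
  rw [policyCost_eq hX hcont hm hc hB]
  simpa [unnormCost] using key T le_rfl

/-- Verification, attainment: if every quantizer in use minimises, the policy costs the value. -/
theorem UsesQuantizers.policyCost_eq_value [IsProbabilityMeasure μ] [TopologicalSpace U]
    [FirstCountableTopology U] [CompactSpace U] [Nonempty U] {η : Policy d M}
    {Q : (t : ℕ) → (Fin t → Fin M) → Quantizer d M} (hQ : UsesQuantizers μ X η Q)
    (hX : S.IsDrivenBy π₀ μ X W)
    (hcont : Continuous (Function.uncurry c₀)) (hm : ∀ u, Measurable fun x => c₀ x u)
    (hc : ∀ x u, 0 ≤ c₀ x u) (hB : ∀ x u, c₀ x u ≤ B)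
    (hmin : ∀ t < T, ∀ q, unnormCost S M c₀ T (T - (t + 1) + 1) (priorLaw μ X η t q) =
      ∑ m, branchCost S M c₀ T (T - (t + 1)) ((priorLaw μ X η t q).restrict ((Q t q).cell m))) :
    policyCost μ X c₀ T η = value S M c₀ T 0 π₀ := by
  have key : ∀ k ≤ T, value S M c₀ T 0 π₀ = ∑ t ∈ Finset.range k, (1 / (T : ℝ)) *
      ∑ q, actionCost c₀ (posteriorLaw μ X η t q) +
        ∑ q, unnormCost S M c₀ T (T - k) (priorLaw μ X η k q) := by
    intro k
    induction k with
    | zero => intro _; simp [← hX.sum_priorLaw_zero η]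
    | succ k ih =>
      intro hk
      rw [ih (by omega), Finset.sum_range_succ, add_assoc, ← hQ.sum_branchCost_eq hX,
        show T - k = T - (k + 1) + 1 by omega]
      simp_rw [hmin k hk]
  rw [policyCost_eq hX hcont hm hc hB, key T le_rfl]
  simp [unnormCost]

end Cost

/-! ### Policies driven by the conditional law -/

section MarkovPolicy

open Set Filter Topology

variable {d M : ℕ} {Ω : Type*} [MeasurableSpace Ω] {S : SourceModel d}
  {π₀ : ProbabilityMeasure (E d)} {μ : Measure Ω} {X W : ℕ → Ω → E d}

theorem exists_usesQuantizers_of_mem_walrandVaraiya [IsProbabilityMeasure μ]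
    {𝒬 : Set (Quantizer d M)} {η : Policy d M} (hη : η ∈ walrandVaraiya μ X 𝒬) :
    ∃ Q : (t : ℕ) → (Fin t → Fin M) → Quantizer d M,
      UsesQuantizers μ X η Q ∧ ∀ t q, Q t q ∈ 𝒬 := by
  obtain ⟨ηhat, h1, h2⟩ := hη
  exact ⟨fun t q => ηhat t ⟨condDistrib (X t) (fun ω => η.messages (fun s => X s ω) t) μ q,
    inferInstance⟩, h2, fun t q => h1 t _⟩

/-- The filter: the conditional law of the state as a function of the messages, computed by
iterating `nextLaw`, when the quantizer at time `t` is `ηhat t` of the conditional law. -/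
noncomputable def filterLaw (S : SourceModel d) (π₀ : ProbabilityMeasure (E d))
    (ηhat : ℕ → ProbabilityMeasure (E d) → Quantizer d M) :
    (t : ℕ) → (Fin t → Fin M) → ProbabilityMeasure (E d)
  | 0, _ => π₀
  | t + 1, q => nextLaw S (filterLaw S π₀ ηhat t (Fin.init q))
      (ηhat t (filterLaw S π₀ ηhat t (Fin.init q))) (q (Fin.last t))

/-- The policy that runs the filter and applies the quantizer which `ηhat` selects from it. -/
noncomputable def filterPolicy (S : SourceModel d) (π₀ : ProbabilityMeasure (E d))
    (ηhat : ℕ → ProbabilityMeasure (E d) → Quantizer d M) : Policy d M where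
  enc t q x := (ηhat t (filterLaw S π₀ ηhat t q)).toFun (x (Fin.last t))
  measurable t := measurable_from_prod_countable_right fun q =>
    (ηhat t (filterLaw S π₀ ηhat t q)).measurable.comp (measurable_pi_apply (Fin.last t))

theorem usesQuantizers_filterPolicy (ηhat : ℕ → ProbabilityMeasure (E d) → Quantizer d M) :
    UsesQuantizers μ X (filterPolicy S π₀ ηhat) fun t q => ηhat t (filterLaw S π₀ ηhat t q) :=
  fun _ => .of_forall fun _ => rfl

theorem SourceModel.IsDrivenBy.exists_priorLaw_eq_smul [IsProbabilityMeasure μ]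
    (hX : S.IsDrivenBy π₀ μ X W) (ηhat : ℕ → ProbabilityMeasure (E d) → Quantizer d M) :
    ∀ (t : ℕ) (q : Fin t → Fin M), ∃ a : ℝ≥0, priorLaw μ X (filterPolicy S π₀ ηhat) t q =
      a • (filterLaw S π₀ ηhat t q : Measure (E d))
  | 0, q => ⟨1, by rw [hX.priorLaw_zero, one_smul, filterLaw]⟩
  | t + 1, q => by
    obtain ⟨a, ha⟩ := hX.exists_priorLaw_eq_smul ηhat t (Fin.init q)
    have hpost := (usesQuantizers_filterPolicy (S := S) (π₀ := π₀) ηhat).posteriorLaw_snoc hX t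
      (Fin.init q) (q (Fin.last t))
    rw [Fin.snoc_init_self, ha, Measure.restrict_smul] at hpost
    rw [hX.priorLaw_succ, hpost, Measure.bind_smul, bind_restrict_cell, smul_smul]
    exact ⟨_, rfl⟩

/-- The filter computes the conditional laws, so the policy is of Walrand–Varaiya type. -/
theorem SourceModel.IsDrivenBy.filterPolicy_mem_walrandVaraiya [IsProbabilityMeasure μ]
    (hX : S.IsDrivenBy π₀ μ X W) {𝒬 : Set (Quantizer d M)}
    {ηhat : ℕ → ProbabilityMeasure (E d) → Quantizer d M} (h𝒬 : ∀ t π, ηhat t π ∈ 𝒬) :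
    filterPolicy S π₀ ηhat ∈ walrandVaraiya μ X 𝒬 := by
  refine ⟨ηhat, h𝒬, fun t => ?_⟩
  set η := filterPolicy S π₀ ηhat with hη
  have hpos : ∀ᵐ ω ∂μ, ∀ q : Fin t → Fin M, μ {ω | η.messages (fun s => X s ω) t = q} = 0 →
      η.messages (fun s => X s ω) t ≠ q := by
    refine ae_all_iff.2 fun q => ?_
    by_cases h : μ {ω | η.messages (fun s => X s ω) t = q} = 0
    · have h' : ∀ᵐ ω ∂μ, ¬ η.messages (fun s => X s ω) t = q := by
        rw [ae_iff]; simpa only [not_not] using h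
      exact h'.mono fun ω hω _ => hω
    · exact .of_forall fun ω h' => absurd h' h
  filter_upwards [hpos] with ω hω
  have hbelief : belief μ X η t ω = filterLaw S π₀ ηhat t (η.messages (fun s => X s ω) t) := by
    obtain ⟨a, ha⟩ := hX.exists_priorLaw_eq_smul ηhat t (η.messages (fun s => X s ω) t)
    exact Subtype.ext (hX.condDistrib_eq η t _ (fun h => hω _ h rfl) a _ ha)
  rw [hbelief]
  rfl

theorem filterLaw_mem {φ : E d → E d → ℝ} {C : ℝ} {K : ℝ≥0} (hφ : S.HasRegularDensity φ C K)
    (ηhat : ℕ → ProbabilityMeasure (E d) → Quantizer d M) :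
    ∀ (t : ℕ) (q : Fin t → Fin M),
      filterLaw S π₀ ηhat t q ∈ regularLaws d C K ∨ (t = 0 ∧ filterLaw S π₀ ηhat t q = π₀)
  | 0, _ => Or.inr ⟨rfl, rfl⟩
  | _ + 1, _ => Or.inl (nextLaw_mem_regularLaws hφ _ _ _)

end MarkovPolicy

end ZeroDelay

theorem theorem4 {d M : ℕ} (hM : 1 ≤ M)
    {U : Type*} [MetricSpace U] [CompactSpace U] [Nonempty U]
    {Ω : Type*} [MeasurableSpace Ω] (μ : Measure Ω) [IsProbabilityMeasure μ]
    (S : ZeroDelay.SourceModel d) (φ : ZeroDelay.E d → ZeroDelay.E d → ℝ) (C : ℝ) (K : ℝ≥0)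
    (hφ : S.HasRegularDensity φ C K)
    (π₀ : ProbabilityMeasure (ZeroDelay.E d))
    (hπ₀ : ZeroDelay.AdmitsDensity π₀ ∨
      ∃ x₀ : ZeroDelay.E d, (π₀ : Measure (ZeroDelay.E d)) = Measure.dirac x₀)
    (X W : ℕ → Ω → ZeroDelay.E d) (hX : S.IsDrivenBy π₀ μ X W)
    (c₀ : ZeroDelay.E d → U → ℝ)
    (hc_nonneg : ∀ x u, 0 ≤ c₀ x u)
    (hc_bdd : ∃ B : ℝ, ∀ x u, c₀ x u ≤ B)
    (hc_cont : Continuous (Function.uncurry c₀))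
    (T : ℕ) (hT : 1 ≤ T) :
    -- an optimal policy exists among those of Walrand–Varaiya type with convex cells
    (∃ η ∈ ZeroDelay.walrandVaraiya μ X (ZeroDelay.convexQuantizers d M),
      ZeroDelay.policyCost μ X c₀ T η =
        ⨅ η' : ZeroDelay.walrandVaraiya μ X (ZeroDelay.convexQuantizers d M),
          ZeroDelay.policyCost μ X c₀ T η'.1) ∧
    -- the minimal cost is the value of the dynamic programming recursion
    IsLeast (ZeroDelay.policyCost μ X c₀ T ''
        ZeroDelay.walrandVaraiya μ X (ZeroDelay.convexQuantizers d M))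
      (ZeroDelay.value S M c₀ T 0 π₀) ∧
    -- the infimum in every step of the recursion is attained
    (∀ t < T, ∀ π : ProbabilityMeasure (ZeroDelay.E d),
      (π ∈ ZeroDelay.regularLaws d C K ∨ (t = 0 ∧ π = π₀)) →
      ∃ Q ∈ ZeroDelay.convexQuantizers d M,
        (∀ Q' ∈ ZeroDelay.convexQuantizers d M,
          (1 / (T : ℝ)) * ZeroDelay.stageCost c₀ π Q +
              ZeroDelay.expectNext S (ZeroDelay.value S M c₀ T (t + 1)) π Q ≤
            (1 / (T : ℝ)) * ZeroDelay.stageCost c₀ π Q' +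
              ZeroDelay.expectNext S (ZeroDelay.value S M c₀ T (t + 1)) π Q') ∧
        ZeroDelay.value S M c₀ T t π = (1 / (T : ℝ)) * ZeroDelay.stageCost c₀ π Q +
          ZeroDelay.expectNext S (ZeroDelay.value S M c₀ T (t + 1)) π Q) ∧
    -- the value functions are continuous on the set of regular laws (weak topology)
    (∀ t < T, ContinuousOn (ZeroDelay.value S M c₀ T t) (ZeroDelay.regularLaws d C K)) := by
  obtain ⟨B, hB⟩ := hc_bdd
  have hm : ∀ u, Measurable fun x => c₀ x u := fun u =>
    (hc_cont.comp (by fun_prop : Continuous fun x : ZeroDelay.E d => (x, u))).measurable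
  have hexists : ∀ t, ∀ π : ProbabilityMeasure (ZeroDelay.E d),
      ∃ Q ∈ ZeroDelay.convexQuantizers d M,
      (π ∈ ZeroDelay.regularLaws d C K ∨ (t = 0 ∧ π = π₀)) →
      ∀ Q' ∈ ZeroDelay.convexQuantizers d M,
      ∑ m, ZeroDelay.branchCost S M c₀ T (T - (t + 1)) ((π : Measure _).restrict (Q.cell m)) ≤
        ∑ m, ZeroDelay.branchCost S M c₀ T (T - (t + 1)) ((π : Measure _).restrict (Q'.cell m)) := by
    intro t π
    obtain ⟨Q₀, hQ₀⟩ := ZeroDelay.nonempty_convexQuantizers (d := d) hM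
    have habs : (π : Measure (ZeroDelay.E d)) ≪ volume → _ := fun h =>
      ZeroDelay.exists_isMinimal_of_absolutelyContinuous (S := S) (T := T) hm hc_nonneg hB hM
        (T - (t + 1)) (π : Measure (ZeroDelay.E d)) h
    by_cases h : π ∈ ZeroDelay.regularLaws d C K ∨ (t = 0 ∧ π = π₀)
    · rcases h with h | ⟨-, rfl⟩
      · obtain ⟨Q, hQ, hQmin⟩ := habs (ZeroDelay.absolutelyContinuous_of_mem_regularLaws h)
        exact ⟨Q, hQ, fun _ => hQmin⟩
      · rcases hπ₀ with ⟨g, -, hg⟩ | ⟨x₀, hx₀⟩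
        · obtain ⟨Q, hQ, hQmin⟩ := habs (hg ▸ withDensity_absolutelyContinuous _ _)
          exact ⟨Q, hQ, fun _ => hQmin⟩
        · refine ⟨Q₀, hQ₀, fun _ Q' _ => ?_⟩
          rw [hx₀, ZeroDelay.sum_branchCost_dirac, ZeroDelay.sum_branchCost_dirac]
    · exact ⟨Q₀, hQ₀, fun h' => absurd h' h⟩
  choose ηhat hconv hmin using hexists
  have hattain : ∀ t, ∀ π : ProbabilityMeasure (ZeroDelay.E d),
      (π ∈ ZeroDelay.regularLaws d C K ∨ (t = 0 ∧ π = π₀)) →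
      ZeroDelay.unnormCost S M c₀ T (T - (t + 1) + 1) π =
        ∑ m, ZeroDelay.branchCost S M c₀ T (T - (t + 1))
          ((π : Measure _).restrict ((ηhat t π).cell m)) := fun t π hπ =>
    have := ZeroDelay.nonempty_convexQuantizers (d := d) hM
    le_antisymm (ZeroDelay.unnormCost_le hc_nonneg _ _ (hconv t π))
      (le_ciInf fun Q => hmin t π hπ Q.1 Q.2)
  have hmem := hX.filterPolicy_mem_walrandVaraiya hconv
  have hcost : ZeroDelay.policyCost μ X c₀ T (ZeroDelay.filterPolicy S π₀ ηhat) =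
      ZeroDelay.value S M c₀ T 0 π₀ := by
    refine (ZeroDelay.usesQuantizers_filterPolicy ηhat).policyCost_eq_value hX hc_cont hm hc_nonneg
      hB fun t _ q => ?_
    obtain ⟨a, ha⟩ := hX.exists_priorLaw_eq_smul ηhat t q
    rw [ha, ZeroDelay.unnormCost_smul, hattain t _ (ZeroDelay.filterLaw_mem hφ ηhat t q),
      Finset.mul_sum]
    refine Finset.sum_congr rfl fun m _ => ?_
    rw [Measure.restrict_smul, ZeroDelay.branchCost_smul]
  have hleast : IsLeast (ZeroDelay.policyCost μ X c₀ T ''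
      ZeroDelay.walrandVaraiya μ X (ZeroDelay.convexQuantizers d M))
      (ZeroDelay.value S M c₀ T 0 π₀) := by
    refine ⟨⟨_, hmem, hcost⟩, ?_⟩
    rintro _ ⟨η, hη, rfl⟩
    obtain ⟨Q, hQ, hQc⟩ := ZeroDelay.exists_usesQuantizers_of_mem_walrandVaraiya hη
    exact hQ.value_le hQc hX hc_cont hm hc_nonneg hB
  refine ⟨⟨_, hmem, ?_⟩, hleast, fun t ht π hπ => ⟨ηhat t π, hconv t π, fun Q' hQ' => ?_, ?_⟩,
    fun t _ => ZeroDelay.continuousOn_costToGo hm hc_nonneg hB hM _⟩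
  · rw [hcost, ← hleast.csInf_eq, sInf_image']
  · simp only [ZeroDelay.value]
    rw [ZeroDelay.stageCost_add_expectNext, ZeroDelay.stageCost_add_expectNext]
    exact hmin t π hπ Q' hQ'
  · simp only [ZeroDelay.value]
    rw [ZeroDelay.stageCost_add_expectNext, ← hattain t π hπ, ZeroDelay.unnormCost_coe,
      show T - (t + 1) + 1 = T - t by omega]
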